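/- Let $\sigma$ be a finite relational vocabulary and let $\varphi$ be a fixed formula of inclusion logic $\mathrm{FO}(\subseteq)$ over $\sigma$, that is, a formula built from the literals $x=y$, $x\neq y$, $R(\bar x)$, $\neg R(\bar x)$ and the inclusion atoms $\bar x\subseteq\bar y$ (with $\bar x,\bar y$ of the same length) by $\wedge,\vee,\exists x,\forall x$, interpreted in (lax) team semantics. For a finite $\sigma$-structure $\mathcal A$ with universe $A$, consider teams $X$ of $\mathcal A$ whose domain is the set $\mathrm{Fr}(\varphi)$ of free variables of $\varphi$, i.e. sets of assignments $\mathrm{Fr}(\varphi)\to A$. Let $\mathrm{EMaxSAT}_\varphi$ be the problem to enumerate, given a finite $\sigma$-structure $\mathcal A$, all teams $X\neq\emptyset$ with $\mathcal A\models_X\varphi$ such that $\mathcal A\not\models_{X'}\varphi$ for all teams $X'\supsetneq X$. Let $\mathrm{ECardMaxSAT}_\varphi$ be the problem to enumerate, given $\mathcal A$, all teams $X\neq\emptyset$ with $\mathcal A\models_X\varphi$ such that $\mathcal A\not\models_{X'}\varphi$ for all teams $X'$ with $|X'|>|X|$. Let $\mathrm{DelP}$ be the class of enumeration problems $E$ for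 which there are a random access machine $M$ (with logarithmic cost), an oracle language $L\in\mathrm P$ and a polynomial $p$ such that on every input word $x$, $M$ with oracle $L$ outputs the solutions of $E$ on $x$, each exactly once, and halts; the time before the first output, between two consecutive outputs, and from the last output until halting is at most $p(|x|)$, and all oracle queries have length at most $p(|x|)$. Structures and teams are coded by binary words: a structure with universe $\{0,\dots,n-1\}$ by $1^n0$ followed by the characteristic words of its relations, a team by the characteristic word of its set of value tuples; a word that codes no structure has no solutions. **Theorem.** $\mathrm{EMaxSAT}_\varphi\in\mathrm{DelP}$ and $\mathrm{ECardMaxSAT}_\varphi\in\mathrm{DelP}$. Moreover, for every finite $\sigma$-structure $\mathcal A$ there is, among all teams $X$ with domain $\mathrm{Fr}(\varphi)$ and $\mathcal A\models_X\varphi$ (the empty team included), a greatest one $T_{\mathcal A}$ with respect to inclusion; for both problems the solution set on $\mathcal A$ is $\{T_{\mathcal A}\}$ if $T_{\mathcal A}\neq\emptyset$ and is empty otherwise; and $T_{\mathcal A}$ is computable from $\mathcal A$ in polynomial time (by a random access machine without oracle). -/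

import Mathlib

namespace TeamEnum

/-! ### First-order team logic with inclusion atoms -/

/-- A finite relational vocabulary: finitely many relation symbols with positive arities. -/
structure Vocabulary where
  numRel : ℕ
  arity : Fin numRel → ℕ
  arity_pos : ∀ i, 0 < arity i

/-- A structure over the vocabulary `σ` with universe `A`. -/
structure Struct (σ : Vocabulary) (A : Type) where
  rel : (i : Fin σ.numRel) → Set (Fin (σ.arity i) → A)

/-- Formulas of inclusion logic over `σ`; the first-order variables are the natural numbers. -/
inductive InclFormula (σ : Vocabulary) : Type
  | eq (x y : ℕ)
  | neq (x y : ℕ)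
  | rel (i : Fin σ.numRel) (x : Fin (σ.arity i) → ℕ)
  | nrel (i : Fin σ.numRel) (x : Fin (σ.arity i) → ℕ)
  | incl (m : ℕ) (x y : Fin m → ℕ)
  | and (φ ψ : InclFormula σ)
  | or (φ ψ : InclFormula σ)
  | ex (x : ℕ) (φ : InclFormula σ)
  | all (x : ℕ) (φ : InclFormula σ)

/-- The free variables of a formula. -/
def InclFormula.free {σ : Vocabulary} : InclFormula σ → Finset ℕ
  | .eq x y => {x, y}
  | .neq x y => {x, y}
  | .rel _ x => Finset.univ.image x
  | .nrel _ x => Finset.univ.image x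
  | .incl _ x y => Finset.univ.image x ∪ Finset.univ.image y
  | .and φ ψ => φ.free ∪ ψ.free
  | .or φ ψ => φ.free ∪ ψ.free
  | .ex x φ => φ.free.erase x
  | .all x φ => φ.free.erase x

/-- Assignments with codomain `A`, as partial functions on the variables: the domain of `s` is
the set of variables `v` with `s v ≠ none`. -/
abbrev Assignment (A : Type) : Type := ℕ → Option A

/-- The assignment `s(a/x)`, with domain `D ∪ {x}` if `s` has domain `D`. -/
def Assignment.supp {A : Type} (s : Assignment A) (x : ℕ) (a : A) : Assignment A :=
  Function.update s x (some a)

/-- The full team with domain `D`: all assignments from `D` to `A`. -/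
def fullTeam (D : Finset ℕ) (A : Type) : Set (Assignment A) :=
  {s | ∀ v, s v ≠ none ↔ v ∈ D}

/-- A team with domain `D` and codomain `A`: a finite set of assignments from `D` to `A`. -/
def IsTeam {A : Type} (D : Finset ℕ) (X : Set (Assignment A)) : Prop :=
  X.Finite ∧ X ⊆ fullTeam D A

/-- The team `X[F/x]`. -/
def supplement {A : Type} (X : Set (Assignment A)) (x : ℕ) (F : Assignment A → Set A) :
    Set (Assignment A) :=
  {t | ∃ s ∈ X, ∃ a ∈ F s, t = s.supp x a}

/-- Team semantics (lax). It is used for sets `X` of assignments whose common domain contains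
the free variables of the formula. -/
def Sat {σ : Vocabulary} {A : Type} (S : Struct σ A) :
    InclFormula σ → Set (Assignment A) → Prop
  | .eq x y, X => ∀ s ∈ X, s x = s y
  | .neq x y, X => ∀ s ∈ X, s x ≠ s y
  | .rel i x, X => ∀ s ∈ X, ∃ a ∈ S.rel i, ∀ j, s (x j) = some (a j)
  | .nrel i x, X => ∀ s ∈ X, ¬ ∃ a ∈ S.rel i, ∀ j, s (x j) = some (a j)
  | .incl _ x y, X => ∀ s ∈ X, ∃ t ∈ X, ∀ j, s (x j) = t (y j)
  | .and φ ψ, X => Sat S φ X ∧ Sat S ψ X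
  | .or φ ψ, X => ∃ Y Z, Y ⊆ X ∧ Z ⊆ X ∧ Y ∪ Z = X ∧ Sat S φ Y ∧ Sat S ψ Z
  | .ex x φ, X => ∃ F : Assignment A → Set A, (∀ s ∈ X, (F s).Nonempty) ∧
      Sat S φ (supplement X x F)
  | .all x φ, X => Sat S φ (supplement X x (fun _ => Set.univ))

/-- The satisfying teams of `φ` in `S`, over the domain of free variables of `φ`
(the empty team included). -/
def satTeams {σ : Vocabulary} {A : Type} (φ : InclFormula σ) (S : Struct σ A) :
    Set (Set (Assignment A)) :=
  {X | IsTeam φ.free X ∧ Sat S φ X}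

/-- The nonempty satisfying teams that are maximal with respect to inclusion. -/
def maxTeams {σ : Vocabulary} {A : Type} (φ : InclFormula σ) (S : Struct σ A) :
    Set (Set (Assignment A)) :=
  {X | IsTeam φ.free X ∧ Sat S φ X ∧ X.Nonempty ∧
    ∀ X', IsTeam φ.free X' → X ⊂ X' → ¬ Sat S φ X'}

/-- The nonempty satisfying teams of maximum cardinality. -/
def cardMaxTeams {σ : Vocabulary} {A : Type} (φ : InclFormula σ) (S : Struct σ A) :
    Set (Set (Assignment A)) :=
  {X | IsTeam φ.free X ∧ Sat S φ X ∧ X.Nonempty ∧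
    ∀ X', IsTeam φ.free X' → X.ncard < X'.ncard → ¬ Sat S φ X'}

/-! ### Encodings as binary words -/

/-- A finite structure, its universe being `{0, …, n - 1}`. -/
structure FinStruct (σ : Vocabulary) where
  n : ℕ
  str : Struct σ (Fin n)

open Classical in
/-- The characteristic word of a set of `k`-tuples over `{0, …, n - 1}`, of length `n ^ k`: the
tuple `t` has position `∑ i, t i * n ^ i`. -/
noncomputable def encTuples {n k : ℕ} (R : Set (Fin k → Fin n)) : List Bool :=
  List.ofFn fun p : Fin (n ^ k) => decide (finFunctionFinEquiv.symm p ∈ R)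

/-- A finite structure is coded by `1 ^ n 0` followed by the characteristic words of its
relations. -/
noncomputable def FinStruct.enc {σ : Vocabulary} (S : FinStruct σ) : List Bool :=
  List.replicate S.n true ++ [false] ++
    (List.ofFn fun i : Fin σ.numRel => encTuples (S.str.rel i)).flatten

/-- A team with domain `D` is coded by the characteristic word of the set of its value tuples,
the variables of `D` being taken in increasing order. -/
noncomputable def encTeam {n : ℕ} (D : Finset ℕ) (X : Set (Assignment (Fin n))) : List Bool :=
  encTuples {t : Fin D.card → Fin n | ∃ s ∈ X, ∀ j, s (D.orderEmbOfFin rfl j) = some (t j)}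

/-! ### Random access machines with an oracle -/

/-- Instructions of a random access machine with registers `R 0, R 1, …`, a read-only input word,
a write-only oracle query, and a write-only output. -/
inductive Instr : Type
  /-- `R i := c` -/
  | const (i c : ℕ)
  /-- `R i := R j + R k` -/
  | add (i j k : ℕ)
  /-- `R i := R j - R k`, truncated at `0` -/
  | sub (i j k : ℕ)
  /-- `R i := R (R j)` -/
  | load (i j : ℕ)
  /-- `R (R i) := R j` -/
  | store (i j : ℕ)
  /-- go to instruction `l` if `R i > 0` -/
  | jpos (i l : ℕ)
  /-- `R i :=` the input bit at position `R j` (as `0` or `1`), or `2` beyond the input -/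
  | read (i j : ℕ)
  /-- append a bit to the oracle query: `1` if `R i > 0`, and `0` otherwise -/
  | queryBit (i : ℕ)
  /-- ask the oracle: `R i := 1` if the query is in the oracle language, otherwise `R i := 0`;
  the query is then erased -/
  | ask (i : ℕ)
  /-- append a bit to the solution being written: `1` if `R i > 0`, and `0` otherwise -/
  | outBit (i : ℕ)
  /-- output the solution that has been written, and start a new one -/
  | output
  | halt

/-- A program: a finite list of instructions, numbered from `0`. -/
abbrev Program : Type := List Instr

/-- A configuration: program counter, registers, oracle query, and current solution. -/
structure Config where
  pc : ℕ
  reg : ℕ → ℕ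
  query : List Bool
  sol : List Bool

/-- The initial configuration. -/
def Config.init : Config where
  pc := 0
  reg := fun _ => 0
  query := []
  sol := []

/-- The current instruction; leaving the program means to halt. -/
def Program.fetch (M : Program) (c : Config) : Instr := (M[c.pc]?).getD Instr.halt

/-- The symbol read at position `i` of the input `x`. -/
def inputSymbol (x : List Bool) (i : ℕ) : ℕ :=
  match x[i]? with
  | none => 2
  | some false => 0
  | some true => 1

/-- Write `v` into register `i` and proceed to the next instruction. -/
def Config.write (c : Config) (i v : ℕ) : Config :=
  { c with pc := c.pc + 1, reg := Function.update c.reg i v }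

open Classical in
/-- The effect of an instruction, with oracle language `L` and input `x`. -/
noncomputable def Instr.exec (L : Set (List Bool)) (x : List Bool) (c : Config) : Instr → Config
  | .const i a => c.write i a
  | .add i j k => c.write i (c.reg j + c.reg k)
  | .sub i j k => c.write i (c.reg j - c.reg k)
  | .load i j => c.write i (c.reg (c.reg j))
  | .store i j => c.write (c.reg i) (c.reg j)
  | .jpos i l => { c with pc := if 0 < c.reg i then l else c.pc + 1 }
  | .read i j => c.write i (inputSymbol x (c.reg j))
  | .queryBit i => { c with pc := c.pc + 1, query := c.query ++ [decide (0 < c.reg i)] }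
  | .ask i => { c.write i (if c.query ∈ L then 1 else 0) with query := [] }
  | .outBit i => { c with pc := c.pc + 1, sol := c.sol ++ [decide (0 < c.reg i)] }
  | .output => { c with pc := c.pc + 1, sol := [] }
  | .halt => c

/-- The logarithmic cost of an instruction: one, plus the binary lengths of the numbers it
handles (an oracle call costs one step). -/
def Instr.cost (c : Config) : Instr → ℕ
  | .const _ a => 1 + a.size
  | .add _ j k => 1 + (c.reg j).size + (c.reg k).size
  | .sub _ j k => 1 + (c.reg j).size + (c.reg k).size
  | .load _ j => 1 + (c.reg j).size + (c.reg (c.reg j)).size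
  | .store i j => 1 + (c.reg i).size + (c.reg j).size
  | .jpos i _ => 1 + (c.reg i).size
  | .read _ j => 1 + (c.reg j).size
  | .queryBit i => 1 + (c.reg i).size
  | .ask _ => 1
  | .outBit i => 1 + (c.reg i).size
  | .output => 1
  | .halt => 1

/-- `Enumerates M L x d c t ws`: the program `M` with oracle `L` on input `x`, started in the
configuration `c` when time `t` has passed since the last output (or since the start), outputs
exactly the words of `ws`, in this order, and halts; every period up to the next output, from one
output to the next, and from the last output until halting takes time at most `d`, and all oracle
queries have length at most `d`. -/
inductive Enumerates (M : Program) (L : Set (List Bool)) (x : List Bool) (d : ℕ) :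
    Config → ℕ → List (List Bool) → Prop
  | halt (c : Config) (t : ℕ) (hc : M.fetch c = Instr.halt) (ht : t + 1 ≤ d) :
      Enumerates M L x d c t []
  | output (c : Config) (t : ℕ) (ws : List (List Bool)) (hc : M.fetch c = Instr.output)
      (ht : t + 1 ≤ d) (h : Enumerates M L x d (Instr.output.exec L x c) 0 ws) :
      Enumerates M L x d c t (c.sol :: ws)
  | step (c : Config) (t : ℕ) (ws : List (List Bool)) (hhalt : M.fetch c ≠ Instr.halt)
      (hout : M.fetch c ≠ Instr.output)
      (hask : ∀ i, M.fetch c = Instr.ask i → c.query.length ≤ d)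
      (h : Enumerates M L x d ((M.fetch c).exec L x c) (t + (M.fetch c).cost c) ws) :
      Enumerates M L x d c t ws

/-! ### Enumeration problems and the class of polynomial delay -/

/-- An enumeration problem: for each input word, the set of its solutions. -/
abbrev EnumProblem : Type := List Bool → Set (List Bool)

/-- The class `Del C`: problems enumerated, without repetition and with polynomial delay, by a
random access machine with an oracle in `C` and polynomially bounded queries. -/
def Del (C : Set (Set (List Bool))) : Set EnumProblem :=
  {E | ∃ L ∈ C, ∃ (M : Program) (p : Polynomial ℕ), ∀ x : List Bool,
    ∃ ws : List (List Bool), ws.Nodup ∧ {w | w ∈ ws} = E x ∧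
      Enumerates M L x (p.eval x.length) Config.init 0 ws}

open Classical in
/-- The class of languages over the binary alphabet decided by a Turing machine in polynomial
time. -/
def PTime : Set (Set (List Bool)) :=
  {L | Nonempty (Turing.TM2ComputableInPolyTime (fun x : List Bool => x)
    Computability.encodeBool (fun x => decide (x ∈ L)))}

/-- The class `DelP`. -/
def DelP : Set EnumProblem := Del PTime

/-- The function `f`, on inputs coded by `ea`, is computed in polynomial time by a random access
machine (whose oracle language is empty, so that the oracle is of no use). -/
def PolyTimeComputable {α : Type} (ea : α → List Bool) (f : α → List Bool) : Prop :=
  ∃ (M : Program) (p : Polynomial ℕ), ∀ a : α,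
    Enumerates M ∅ (ea a) (p.eval (ea a).length) Config.init 0 [f a]

/-- The problem to enumerate, for a given finite structure, all nonempty satisfying teams of `φ`
that are maximal with respect to inclusion. -/
def EMaxSat {σ : Vocabulary} (φ : InclFormula σ) : EnumProblem := fun x =>
  {w | ∃ S : FinStruct σ, x = S.enc ∧ ∃ X ∈ maxTeams φ S.str, w = encTeam φ.free X}

/-- The problem to enumerate, for a given finite structure, all nonempty satisfying teams of `φ`
of maximum cardinality. -/
def ECardMaxSat {σ : Vocabulary} (φ : InclFormula σ) : EnumProblem := fun x =>
  {w | ∃ S : FinStruct σ, x = S.enc ∧ ∃ X ∈ cardMaxTeams φ S.str, w = encTeam φ.free X}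

end TeamEnum

open TeamEnum

/-!
Teams that satisfy a formula of inclusion logic are closed under unions, so every team `X` has a
greatest satisfying subteam, and for nonempty solutions both maximality conditions single out the
greatest satisfying subteam of the full team. It is computed recursively, for the connectives `∃`
and `∨` in one pass and for `∧`, `∀` and inclusion atoms as the limit of a decreasing sequence of
subteams of `X`. Such a sequence is stationary after at most `n ^ |D|` steps, where `n` is the size
of the universe and `D` the domain of the teams, and this is polynomial since `φ` is fixed. As there
is at most one solution, its computation within the first delay needs no oracle, and the empty
language serves as one.
-/

namespace TeamEnum

/-- A Turing machine that erases its input and rejects. -/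
def rejectComputer : Turing.FinTM2 where
  K := Unit
  k₀ := ()
  k₁ := ()
  Γ _ := Bool
  Λ := Unit
  main := ()
  σ := Bool
  initialState := false
  Γk₀Fin := inferInstanceAs (Fintype Bool)
  m _ := .pop () (fun _ o => o.isNone)
    (.branch id (.push () (fun _ => false) (.load (fun _ => false) .halt)) (.goto fun _ => ()))

theorem rejectComputer_run (l : List Bool) :
    (flip bind rejectComputer.step)^[l.length + 1]
      (some (⟨some (), false, fun _ => l⟩ : Turing.TM2.Cfg (fun _ : Unit => Bool) Unit Bool)) =
    some (⟨none, false, fun _ => [false]⟩ : Turing.TM2.Cfg (fun _ : Unit => Bool) Unit Bool) := by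
  induction l with
  | nil =>
    exact congrArg (fun S => some (⟨none, false, S⟩ :
      Turing.TM2.Cfg (fun _ : Unit => Bool) Unit Bool)) (funext fun k => rfl)
  | cons b l ih =>
    rw [List.length_cons, Function.iterate_succ_apply, ← ih]
    exact congrArg
      (fun S => (flip bind rejectComputer.step)^[l.length + 1] (some ⟨some (), false, S⟩))
      (funext fun k => rfl)

theorem empty_mem_pTime : (∅ : Set (List Bool)) ∈ PTime := by
  refine ⟨⟨⟨rejectComputer, Equiv.refl _, Equiv.refl _⟩, Polynomial.X + 1, fun l => ?_⟩⟩
  refine ⟨⟨l.length + 1, ?_⟩, by simp⟩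
  have hmap : List.map (Equiv.refl (rejectComputer.Γ rejectComputer.k₀)).invFun l = l :=
    List.map_id l
  have hdec : false = @decide (l ∈ (∅ : Set (List Bool))) (Classical.propDecidable _) := by simp
  exact (congrArg (fun l' => (flip bind rejectComputer.step)^[l.length + 1]
    (some (Turing.initList rejectComputer l'))) hmap).trans
    ((rejectComputer_run l).trans
      (congrArg (fun b => some (Turing.haltList rejectComputer [b])) hdec))

/-! ### Runs of query-free programs -/

/-- The binary length of the constant loaded by an instruction. -/
def Instr.constSize : Instr → ℕ
  | .const _ a => a.size
  | _ => 0

/-- A program that never extends the oracle query. -/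
def Program.QueryFree (M : Program) : Prop := ∀ i, Instr.queryBit i ∉ M

theorem Program.exists_constSize_le (M : Program) : ∃ b, ∀ I ∈ M, I.constSize ≤ b :=
  ⟨(M.map Instr.constSize).sum, fun _ hI => List.le_sum_of_mem (List.mem_map_of_mem hI)⟩

theorem Program.fetch_mem_or_eq_halt (M : Program) (c : Config) :
    M.fetch c ∈ M ∨ M.fetch c = .halt := by
  unfold Program.fetch
  cases h : M[c.pc]? with
  | none => exact Or.inr rfl
  | some I => exact Or.inl (List.mem_of_getElem? h)

theorem Program.constSize_fetch_le {M : Program} {b : ℕ} (hM : ∀ I ∈ M, I.constSize ≤ b)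
    (c : Config) : (M.fetch c).constSize ≤ b := by
  rcases M.fetch_mem_or_eq_halt c with h | h
  · exact hM _ h
  · simp [h, Instr.constSize]

theorem Program.QueryFree.fetch_ne {M : Program} (hM : M.QueryFree) (c : Config) (i : ℕ) :
    M.fetch c ≠ .queryBit i := by
  intro h
  rcases M.fetch_mem_or_eq_halt c with h' | h'
  · exact hM i (h ▸ h')
  · simp [h'] at h

/-- The registers of the configuration have binary length at most `b`, and no query has been
written. -/
structure Config.Fits (c : Config) (b : ℕ) : Prop where
  size_le : ∀ r, (c.reg r).size ≤ b
  query_eq : c.query = []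

theorem size_add_le {a a' b : ℕ} (ha : a.size ≤ b) (ha' : a'.size ≤ b) :
    (a + a').size ≤ b + 1 := by
  rw [Nat.size_le] at *
  rw [pow_succ]
  omega

theorem size_inputSymbol_le (x : List Bool) (i : ℕ) : (inputSymbol x i).size ≤ 2 := by
  rw [Nat.size_le]
  unfold inputSymbol
  split <;> norm_num

theorem Config.Fits.write {c : Config} {b v : ℕ} (hc : c.Fits b) (i : ℕ) (hv : v.size ≤ b + 1) :
    (c.write i v).Fits (b + 1) := by
  refine ⟨fun r => ?_, hc.query_eq⟩
  simp only [Config.write, Function.update_apply]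
  split
  · exact hv
  · exact (hc.size_le r).trans b.le_succ

theorem Config.Fits.exec {c : Config} {b : ℕ} (hb : 2 ≤ b) (hc : c.Fits b) {I : Instr}
    (hconst : I.constSize ≤ b) (hquery : ∀ i, I ≠ .queryBit i) (x : List Bool) :
    (I.exec ∅ x c).Fits (b + 1) := by
  have hc' : c.Fits (b + 1) := ⟨fun r => (hc.size_le r).trans b.le_succ, hc.query_eq⟩
  cases I with
  | const i a => exact hc.write _ (hconst.trans b.le_succ)
  | add i j k => exact hc.write _ (size_add_le (hc.size_le _) (hc.size_le _))
  | sub i j k => exact hc.write _ ((Nat.size_le_size (Nat.sub_le _ _)).trans (hc'.size_le _))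
  | load i j => exact hc.write _ (hc'.size_le _)
  | store i j => exact hc.write _ (hc'.size_le _)
  | read i j => exact hc.write _ ((size_inputSymbol_le _ _).trans (by omega))
  | queryBit i => exact absurd rfl (hquery i)
  | ask i => exact ⟨(hc.write i (by simp)).size_le, rfl⟩
  | jpos | outBit | output | halt => exact ⟨hc'.size_le, hc.query_eq⟩

theorem Config.Fits.cost_le {c : Config} {b : ℕ} (hc : c.Fits b) {I : Instr}
    (hconst : I.constSize ≤ b) : I.cost c ≤ 1 + 2 * b := by
  have h := hc.size_le
  cases I with
  | const i a => simp only [Instr.constSize] at hconst; simp only [Instr.cost]; omega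
  | add i j k | sub i j k => have := h j; have := h k; simp only [Instr.cost]; omega
  | load i j => have := h j; have := h (c.reg j); simp only [Instr.cost]; omega
  | store i j => have := h i; have := h j; simp only [Instr.cost]; omega
  | read i j => have := h j; simp only [Instr.cost]; omega
  | jpos i | queryBit i | outBit i => have := h i; simp only [Instr.cost]; omega
  | ask | output | halt => simp only [Instr.cost]; omega

/-- The solution output by an instruction, if any. -/
def Instr.emitted (c : Config) : Instr → List (List Bool)
  | .output => [c.sol]
  | _ => []

/-- `Runs M x T c ws c'`: on input `x` and with empty oracle, `T` steps of the program `M` lead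
from `c` to `c'` and output the words of `ws`. -/
inductive Runs (M : Program) (x : List Bool) : ℕ → Config → List (List Bool) → Config → Prop
  | refl (c : Config) : Runs M x 0 c [] c
  | step {T : ℕ} {c c' : Config} {ws : List (List Bool)}
      (h : Runs M x T ((M.fetch c).exec ∅ x c) ws c') :
      Runs M x (T + 1) c ((M.fetch c).emitted c ++ ws) c'

theorem Runs.single (M : Program) (x : List Bool) (c : Config) :
    Runs M x 1 c ((M.fetch c).emitted c) ((M.fetch c).exec ∅ x c) := by
  simpa using Runs.step (Runs.refl (M := M) (x := x) ((M.fetch c).exec ∅ x c))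

theorem Runs.trans {M : Program} {x : List Bool} {T T' : ℕ} {c c' c'' : Config}
    {ws ws' : List (List Bool)} (h : Runs M x T c ws c') (h' : Runs M x T' c' ws' c'') :
    Runs M x (T + T') c (ws ++ ws') c'' := by
  induction h with
  | refl c => simpa using h'
  | step _ ih => simpa [Nat.add_right_comm] using Runs.step (ih h')

/-- Registers grow by at most one bit per step, so `T` steps cost `O(T * (b + T))`, and this bounds
every delay. -/
theorem Runs.enumerates {M : Program} (hM : M.QueryFree) {b₀ : ℕ}
    (hb₀ : ∀ I ∈ M, I.constSize ≤ b₀) {x : List Bool} {T d : ℕ} {c c' : Config}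
    {ws : List (List Bool)} (hrun : Runs M x T c ws c') (hhalt : M.fetch c' = .halt) {b t : ℕ}
    (hb : 2 ≤ b) (hb₀b : b₀ ≤ b) (hc : c.Fits b) (hd : t + T * (1 + 2 * (b + T)) + 1 ≤ d) :
    Enumerates M ∅ x d c t ws := by
  induction hrun generalizing b t with
  | refl c => exact .halt _ _ hhalt (by omega)
  | @step T c c' ws _ ih =>
    have hconst := (M.constSize_fetch_le hb₀ c).trans hb₀b
    have hcost := hc.cost_le hconst
    have hexec := hc.exec hb hconst (hM.fetch_ne c) x
    have hsucc : (T + 1) * (1 + 2 * (b + (T + 1))) =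
        T * (1 + 2 * (b + 1 + T)) + (1 + 2 * (b + (T + 1))) := by ring
    by_cases hh : M.fetch c = .halt
    · rw [hh] at ih ⊢
      exact ih hhalt hb hb₀b hc (by nlinarith)
    by_cases ho : M.fetch c = .output
    · rw [ho] at ih hexec ⊢
      exact .output _ _ _ ho (by omega) (ih hhalt (by omega) (by omega) hexec (by omega))
    · have hnone : (M.fetch c).emitted c = [] := by
        cases h : M.fetch c <;> simp_all [Instr.emitted]
      rw [hnone]
      exact .step _ _ _ hh ho (fun i _ => by simp [hc.query_eq])
        (ih hhalt (by omega) (by omega) hexec (by omega))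

/-! ### Memory layout -/

/-- The size of the universe announced by a word: its number of leading ones. -/
def univSize (x : List Bool) : ℕ := (x.takeWhile id).length

theorem univSize_le (x : List Bool) : univSize x ≤ x.length := (List.takeWhile_prefix _).length_le

/-- The scalar variables of structured programs: a scratch register for addresses, the values of
the first-order variables, and work registers. -/
inductive Reg : Type
  | addr
  | var (y : ℕ)
  | work (j : ℕ)
  deriving DecidableEq

/-- The machine register of a scalar. The registers `1`, `3` and `5` are reserved for constants. -/
def Reg.phys : Reg → ℕ
  | .addr => 0
  | .var y => 4 * y + 7
  | .work j => 4 * j + 9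

/-- The machine register of the entry `a` of the array `q`: every positive even number is used
exactly once. -/
def cell (q a : ℕ) : ℕ := 2 ^ (q + 1) * (2 * a + 1)

theorem Reg.phys_injective : Function.Injective Reg.phys := by
  rintro (_ | x | x) (_ | y | y) h <;> simp only [Reg.phys] at h <;>
    first | rfl | omega | (congr 1; omega)

theorem Reg.phys_ne_const (r : Reg) : r.phys ≠ 1 ∧ r.phys ≠ 3 ∧ r.phys ≠ 5 := by
  rcases r with _ | x | x <;> simp only [Reg.phys] <;> omega

theorem cell_eq_two_mul (q a : ℕ) : cell q a = 2 * (2 ^ q * (2 * a + 1)) := by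
  rw [cell, pow_succ]
  ring

theorem cell_ne_phys (q a : ℕ) (r : Reg) : cell q a ≠ r.phys := by
  have : 0 < 2 ^ q * (2 * a + 1) := by positivity
  rw [cell_eq_two_mul]
  rcases r with _ | x | x <;> simp only [Reg.phys] <;> omega

theorem cell_ne_const (q a : ℕ) : cell q a ≠ 1 ∧ cell q a ≠ 3 ∧ cell q a ≠ 5 := by
  rw [cell_eq_two_mul]
  omega

theorem padicValNat_two_cell (q a : ℕ) : padicValNat 2 (cell q a) = q + 1 := by
  rw [cell, padicValNat.mul (by positivity) (by omega), padicValNat.prime_pow,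
    padicValNat.eq_zero_of_not_dvd (by omega), add_zero]

theorem cell_inj {q a q' a' : ℕ} : cell q a = cell q' a' ↔ q = q' ∧ a = a' := by
  refine ⟨fun h => ?_, by rintro ⟨rfl, rfl⟩; rfl⟩
  have hq := congrArg (padicValNat 2) h
  rw [padicValNat_two_cell, padicValNat_two_cell, Nat.add_right_cancel_iff] at hq
  subst hq
  have := Nat.eq_of_mul_eq_mul_left (by positivity) h
  exact ⟨rfl, by omega⟩

/-- The data a structured program works on: arrays of numbers, the solution being written, and
the solutions output so far. -/
structure Data where
  arr : ℕ → ℕ → ℕ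
  sol : List Bool
  outs : List (List Bool)

/-- The data at the start of a program. -/
def Data.init : Data := ⟨fun _ _ => 0, [], []⟩

/-- Store `b` as the entry `a` of the array `q`. -/
def Data.setArr (D : Data) (q a b : ℕ) : Data :=
  { D with arr := Function.update D.arr q (Function.update (D.arr q) a b) }

/-- Append a bit to the solution being written. -/
def Data.writeBit (D : Data) (b : Bool) : Data := { D with sol := D.sol ++ [b] }

/-- Output the solution being written and start a new one. -/
def Data.output (D : Data) : Data := { D with sol := [], outs := D.outs ++ [D.sol] }

/-- The state of a structured program. -/
structure MState where
  v : Reg → ℕ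
  data : Data

/-- Assign a value to a scalar. -/
def MState.set (s : MState) (r : Reg) (a : ℕ) : MState :=
  { s with v := Function.update s.v r a }

/-- The values of the first-order variables. -/
def MState.env (s : MState) : ℕ → ℕ := fun y => s.v (.var y)

@[simp] theorem MState.set_v (s : MState) (r r' : Reg) (a : ℕ) :
    (s.set r a).v r' = if r' = r then a else s.v r' := by
  simp [MState.set, Function.update_apply]

@[simp] theorem MState.set_data (s : MState) (r : Reg) (a : ℕ) : (s.set r a).data = s.data := rfl

@[simp] theorem MState.env_set_var (s : MState) (y a : ℕ) :
    (s.set (.var y) a).env = Function.update s.env y a := by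
  funext z
  simp [MState.env, Function.update_apply]

/-- A machine configuration holds the scalars, arrays and current solution of a state, and the
constants `1`, the size of the universe, and `0` in the registers `1`, `3` and `5`. -/
structure Represents (x : List Bool) (s : MState) (c : Config) : Prop where
  one : c.reg 1 = 1
  size : c.reg 3 = univSize x
  zero : c.reg 5 = 0
  scalar : ∀ r, c.reg (Reg.phys r) = s.v r
  array : ∀ q a, c.reg (cell q a) = s.data.arr q a
  sol : c.sol = s.data.sol

theorem Represents.jump {x : List Bool} {s : MState} {c : Config} (h : Represents x s c) (l : ℕ) :
    Represents x s { c with pc := l } :=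
  ⟨h.one, h.size, h.zero, h.scalar, h.array, h.sol⟩

theorem Represents.write_scalar {x : List Bool} {s : MState} {c : Config} (h : Represents x s c)
    (r : Reg) (a : ℕ) : Represents x (s.set r a) (c.write r.phys a) where
  one := (Function.update_of_ne r.phys_ne_const.1.symm _ _).trans h.one
  size := (Function.update_of_ne r.phys_ne_const.2.1.symm _ _).trans h.size
  zero := (Function.update_of_ne r.phys_ne_const.2.2.symm _ _).trans h.zero
  scalar r' := by
    simp only [Config.write, MState.set, Function.update_apply, Reg.phys_injective.eq_iff, h.scalar]
  array q b := (Function.update_of_ne (cell_ne_phys q b r) _ _).trans (h.array q b)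
  sol := h.sol

theorem Represents.write_cell {x : List Bool} {s : MState} {c : Config} (h : Represents x s c)
    (q a b : ℕ) :
    Represents x { s with data := s.data.setArr q a b } (c.write (cell q a) b) where
  one := (Function.update_of_ne (cell_ne_const q a).1.symm _ _).trans h.one
  size := (Function.update_of_ne (cell_ne_const q a).2.1.symm _ _).trans h.size
  zero := (Function.update_of_ne (cell_ne_const q a).2.2.symm _ _).trans h.zero
  scalar r := (Function.update_of_ne (cell_ne_phys q a r).symm _ _).trans (h.scalar r)
  array q' a' := by
    simp only [Config.write, Data.setArr, Function.update_apply, cell_inj, h.array]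
    by_cases hq : q' = q
    · subst hq
      simp [Function.update_apply]
    · simp [hq]
  sol := h.sol

/-! ### Segments of a program -/

/-- The program `M` contains `code` from position `a` on. -/
def Program.Contains (M : Program) (a : ℕ) (code : Program) : Prop := code <+: M.drop a

theorem Program.contains_cons {M code : Program} {a : ℕ} {I : Instr} :
    M.Contains a (I :: code) ↔ M[a]? = some I ∧ M.Contains (a + 1) code := by
  unfold Program.Contains
  rw [← List.drop_drop, ← List.head?_drop]
  cases M.drop a <;> simp [List.cons_prefix_cons, eq_comm]

theorem Program.contains_append {M code code' : Program} {a : ℕ} :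
    M.Contains a (code ++ code') ↔ M.Contains a code ∧ M.Contains (a + code.length) code' := by
  induction code generalizing a with
  | nil => simp [Program.Contains]
  | cons I code ih =>
    rw [List.cons_append, contains_cons, contains_cons, ih, List.length_cons, and_assoc,
      Nat.add_right_comm a, Nat.add_assoc]

theorem Program.fetch_eq {M : Program} {c : Config} {I : Instr} (h : M[c.pc]? = some I) :
    M.fetch c = I := by
  rw [Program.fetch, h, Option.getD_some]

theorem Runs.of_getElem? {M : Program} {c : Config} {I : Instr} (x : List Bool)
    (h : M[c.pc]? = some I) : Runs M x 1 c (I.emitted c) (I.exec ∅ x c) := by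
  simpa only [Program.fetch_eq h] using Runs.single M x c

theorem Runs.jpos {M : Program} {c : Config} {i l : ℕ} (x : List Bool)
    (h : M[c.pc]? = some (.jpos i l)) :
    Runs M x 1 c [] { c with pc := if 0 < c.reg i then l else c.pc + 1 } :=
  .of_getElem? x h

/-- From position `a` in state `s`, the program `M` reaches position `b` in state `s'` within `n`
steps. -/
def Leads (M : Program) (x : List Bool) (n a : ℕ) (s : MState) (b : ℕ) (s' : MState) : Prop :=
  ∀ c, c.pc = a → Represents x s c → ∃ T ≤ n, ∃ ws c', Runs M x T c ws c' ∧ c'.pc = b ∧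
    Represents x s' c' ∧ s'.data.outs = s.data.outs ++ ws

theorem Leads.refl (M : Program) (x : List Bool) (a : ℕ) (s : MState) : Leads M x 0 a s a s :=
  fun c hc hs => ⟨0, le_rfl, [], c, .refl c, hc, hs, (List.append_nil _).symm⟩

theorem Leads.trans {M : Program} {x : List Bool} {n n' a b b' : ℕ} {s s' s'' : MState}
    (h : Leads M x n a s b s') (h' : Leads M x n' b s' b' s'') :
    Leads M x (n + n') a s b' s'' := by
  intro c hc hs
  obtain ⟨T, hT, ws, c', hrun, hc', hs', ho⟩ := h c hc hs
  obtain ⟨T', hT', ws', c'', hrun', hc'', hs'', ho'⟩ := h' c' hc' hs'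
  exact ⟨T + T', Nat.add_le_add hT hT', ws ++ ws', c'', hrun.trans hrun', hc'', hs'',
    by rw [ho', ho, List.append_assoc]⟩

theorem Leads.mono {M : Program} {x : List Bool} {n n' a b : ℕ} {s s' : MState}
    (h : Leads M x n a s b s') (hn : n ≤ n') : Leads M x n' a s b s' := fun c hc hs =>
  let ⟨T, hT, rest⟩ := h c hc hs
  ⟨T, hT.trans hn, rest⟩

/-- On configurations that represent `s`, the instruction proceeds to the next one and makes them
represent `s'`. -/
def Instr.Effect (I : Instr) (x : List Bool) (s s' : MState) : Prop :=
  ∀ c, Represents x s c → (I.exec ∅ x c).pc = c.pc + 1 ∧ Represents x s' (I.exec ∅ x c) ∧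
    s'.data.outs = s.data.outs ++ I.emitted c

theorem Instr.Effect.leads {I : Instr} {x : List Bool} {s s' : MState} (hI : I.Effect x s s')
    {M : Program} {a : ℕ} (hM : M[a]? = some I) : Leads M x 1 a s (a + 1) s' := by
  rintro c rfl hs
  obtain ⟨hpc, hs', ho⟩ := hI c hs
  exact ⟨1, le_rfl, _, _, .of_getElem? x hM, hpc, hs', ho⟩

theorem Leads.jump {M : Program} {x : List Bool} {a i l b : ℕ} {s : MState}
    (hM : M[a]? = some (.jpos i l))
    (hb : ∀ c, Represents x s c → (if 0 < c.reg i then l else a + 1) = b) :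
    Leads M x 1 a s b s := by
  rintro c rfl hs
  exact ⟨1, le_rfl, [], _, .jpos x hM, hb c hs, hs.jump _, (List.append_nil _).symm⟩

theorem Leads.jpos_of_pos {M : Program} {x : List Bool} {a l : ℕ} {s : MState} {r : Reg}
    (hM : M[a]? = some (.jpos r.phys l)) (hr : 0 < s.v r) : Leads M x 1 a s l s :=
  .jump hM fun c hs => by rw [hs.scalar, if_pos hr]

theorem Leads.jpos_of_eq_zero {M : Program} {x : List Bool} {a l : ℕ} {s : MState} {r : Reg}
    (hM : M[a]? = some (.jpos r.phys l)) (hr : s.v r = 0) : Leads M x 1 a s (a + 1) s :=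
  .jump hM fun c hs => by rw [hs.scalar, hr, if_neg (lt_irrefl 0)]

theorem Leads.goto {M : Program} {x : List Bool} {a l : ℕ} (hM : M[a]? = some (.jpos 1 l))
    (s : MState) : Leads M x 1 a s l s :=
  .jump hM fun c hs => by rw [hs.one, if_pos one_pos]

/-! ### Implementable state transformers -/

/-- The state transformer, which may depend on the input, is computed by a query-free program
segment with a polynomial number of steps. The segment `code a` is the one to be placed at
position `a`. -/
def Impl (f : List Bool → MState → MState) : Prop :=
  ∃ (p : Polynomial ℕ) (len : ℕ) (code : ℕ → Program),
    (∀ a, (code a).length = len ∧ (code a).QueryFree) ∧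
    ∀ M a x, Program.Contains M a (code a) →
      ∀ s, Leads M x (p.eval x.length) a s (a + len) (f x s)

theorem Program.QueryFree.append {M N : Program} (hM : M.QueryFree) (hN : N.QueryFree) :
    Program.QueryFree (M ++ N) := fun i h => (List.mem_append.1 h).elim (hM i) (hN i)

theorem Impl.id : Impl fun _ s => s :=
  ⟨0, 0, fun _ => [], fun _ => ⟨rfl, by simp [Program.QueryFree]⟩,
    fun M a x _ s => by simpa using Leads.refl M x a s⟩

theorem Impl.comp {f g : List Bool → MState → MState} (hg : Impl g) (hf : Impl f) :
    Impl fun x s => g x (f x s) := by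
  obtain ⟨p, l, code, hl, h⟩ := hf
  obtain ⟨p', l', code', hl', h'⟩ := hg
  refine ⟨p + p', l + l', fun a => code a ++ code' (a + l), fun a =>
    ⟨by simp [(hl _).1, (hl' _).1], (hl _).2.append (hl' _).2⟩, fun M a x hM s => ?_⟩
  rw [Program.contains_append, (hl a).1] at hM
  rw [Polynomial.eval_add, ← add_assoc]
  exact (h M a x hM.1 s).trans (h' M _ x hM.2 _)

theorem Impl.snoc {f g : List Bool → MState → MState} (hf : Impl f) (I : Instr)
    (hquery : ∀ i, I ≠ .queryBit i) (hI : ∀ x s, I.Effect x (f x s) (g x s)) : Impl g := by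
  obtain ⟨p, l, code, hl, h⟩ := hf
  refine ⟨p + 1, l + 1, fun a => code a ++ [I], fun a => ⟨by simp [(hl _).1], (hl _).2.append
    fun i hi => hquery i (List.mem_singleton.1 hi).symm⟩, fun M a x hM s => ?_⟩
  rw [Program.contains_append, Program.contains_cons, (hl a).1] at hM
  rw [Polynomial.eval_add, Polynomial.eval_one, ← add_assoc]
  exact (h M a x hM.1 s).trans ((hI x s).leads hM.2.1)

theorem Impl.instr {f : List Bool → MState → MState} (I : Instr) (hquery : ∀ i, I ≠ .queryBit i)
    (hI : ∀ x s, I.Effect x s (f x s)) : Impl f :=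
  Impl.id.snoc I hquery hI

theorem Instr.effect_of_exec_eq_write {x : List Bool} {s : MState} {I : Instr} {r : Reg}
    {v : ℕ} (hI : ∀ c, Represents x s c → I.exec ∅ x c = c.write r.phys v)
    (hout : ∀ c, I.emitted c = []) : I.Effect x s (s.set r v) := by
  intro c hs
  rw [hI c hs, hout]
  exact ⟨rfl, hs.write_scalar r v, (List.append_nil _).symm⟩

theorem Impl.const (r : Reg) (a : ℕ) : Impl fun _ s => s.set r a :=
  .instr (.const r.phys a) nofun fun _ _ =>
    Instr.effect_of_exec_eq_write (fun _ _ => rfl) fun _ => rfl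

theorem Impl.add (r i j : Reg) : Impl fun _ s => s.set r (s.v i + s.v j) :=
  .instr (.add r.phys i.phys j.phys) nofun fun _ _ =>
    Instr.effect_of_exec_eq_write (fun _ h => by rw [Instr.exec, h.scalar, h.scalar])
      fun _ => rfl

theorem Impl.sub (r i j : Reg) : Impl fun _ s => s.set r (s.v i - s.v j) :=
  .instr (.sub r.phys i.phys j.phys) nofun fun _ _ =>
    Instr.effect_of_exec_eq_write (fun _ h => by rw [Instr.exec, h.scalar, h.scalar])
      fun _ => rfl

theorem Impl.move (r i : Reg) : Impl fun _ s => s.set r (s.v i) :=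
  .instr (.add r.phys i.phys 5) nofun fun _ _ =>
    Instr.effect_of_exec_eq_write (fun _ h => by rw [Instr.exec, h.scalar, h.zero, add_zero])
      fun _ => rfl

theorem Impl.addOne (r i : Reg) : Impl fun _ s => s.set r (s.v i + 1) :=
  .instr (.add r.phys i.phys 1) nofun fun _ _ =>
    Instr.effect_of_exec_eq_write (fun _ h => by rw [Instr.exec, h.scalar, h.one]) fun _ => rfl

theorem Impl.input (r i : Reg) : Impl fun x s => s.set r (inputSymbol x (s.v i)) :=
  .instr (.read r.phys i.phys) nofun fun _ _ =>
    Instr.effect_of_exec_eq_write (fun _ h => by rw [Instr.exec, h.scalar]) fun _ => rfl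

theorem Impl.outBit (r : Reg) :
    Impl fun _ s => { s with data := s.data.writeBit (decide (0 < s.v r)) } :=
  .instr (.outBit r.phys) nofun fun _ _ _ h =>
    ⟨rfl, ⟨h.one, h.size, h.zero, h.scalar, h.array, by
      simp only [Instr.exec, Data.writeBit, h.sol, h.scalar]⟩, (List.append_nil _).symm⟩

theorem Impl.output : Impl fun _ s => { s with data := s.data.output } :=
  .instr .output nofun fun _ _ _ h =>
    ⟨rfl, ⟨h.one, h.size, h.zero, h.scalar, h.array, rfl⟩, by
      simp only [Instr.emitted, Data.output, h.sol]⟩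

theorem MState.set_set (s : MState) (r : Reg) (a b : ℕ) : (s.set r a).set r b = s.set r b := by
  simp [MState.set]

theorem Impl.mulTwoPow (r : Reg) (m : ℕ) : Impl fun _ s => s.set r (2 ^ m * s.v r) := by
  induction m with
  | zero => simpa [MState.set] using Impl.id
  | succ m ih => simpa [pow_succ', two_mul, add_mul, MState.set_set] using (Impl.add r r r).comp ih

theorem Impl.address (q : ℕ) (i : Reg) : Impl fun _ s => s.set .addr (cell q (s.v i)) := by
  have := (Impl.mulTwoPow .addr (q + 1)).comp
    ((Impl.addOne .addr .addr).comp (Impl.add .addr i i))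
  simpa [MState.set_set, cell, two_mul] using this

theorem Impl.load (r : Reg) (q : ℕ) (i : Reg) :
    Impl fun _ s => (s.set .addr (cell q (s.v i))).set r (s.data.arr q (s.v i)) :=
  (Impl.address q i).snoc (.load r.phys Reg.addr.phys) nofun fun _ s =>
    Instr.effect_of_exec_eq_write (fun c h => by
      rw [Instr.exec, h.scalar, MState.set_v, if_pos rfl, h.array, MState.set_data]) fun _ => rfl

theorem Impl.store (q : ℕ) {i j : Reg} (hj : j ≠ .addr) :
    Impl fun _ s =>
      { s.set .addr (cell q (s.v i)) with data := s.data.setArr q (s.v i) (s.v j) } := by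
  refine (Impl.address q i).snoc (.store Reg.addr.phys j.phys) nofun fun x s c h => ?_
  have he : (Instr.store Reg.addr.phys j.phys).exec ∅ x c =
      c.write (cell q (s.v i)) (s.v j) := by
    simp [Instr.exec, h.scalar, hj]
  rw [he]
  exact ⟨rfl, h.write_cell q (s.v i) (s.v j), (List.append_nil _).symm⟩

theorem Impl.ite (r : Reg) {f g : List Bool → MState → MState} (hf : Impl f) (hg : Impl g) :
    Impl fun x s => if 0 < s.v r then f x s else g x s := by
  obtain ⟨p, l, code, hl, h⟩ := hf
  obtain ⟨p', l', code', hl', h'⟩ := hg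
  refine ⟨p + p' + Polynomial.C 2, l' + l + 2, fun a => .jpos r.phys (a + 1 + l' + 1) ::
    (code' (a + 1) ++ .jpos 1 (a + 1 + l' + 1 + l) :: code (a + 1 + l' + 1)),
    fun a => ⟨by simp [(hl _).1, (hl' _).1]; omega, ?_⟩, fun M a x hM s => ?_⟩
  · exact Program.QueryFree.append (M := [_]) (by simp [Program.QueryFree])
      ((hl' _).2.append (.append (M := [_]) (by simp [Program.QueryFree]) (hl _).2))
  rw [Program.contains_cons, Program.contains_append, Program.contains_cons, (hl' _).1] at hM
  obtain ⟨hbranch, helse, hgoto, hthen⟩ := hM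
  simp only [Polynomial.eval_add, Polynomial.eval_C]
  have hend : a + (l' + l + 2) = a + 1 + l' + 1 + l := by omega
  rw [hend]
  split_ifs with hr
  · exact ((Leads.jpos_of_pos hbranch hr).trans (h M _ x hthen s)).mono (by omega)
  · exact (((Leads.jpos_of_eq_zero hbranch (by omega)).trans (h' M _ x helse s)).trans
      (.goto hgoto _)).mono (by omega)

/-- Execute `f`, then decrease the counter `r`. -/
def countDown (r : Reg) (f : MState → MState) (s : MState) : MState := (f s).set r ((f s).v r - 1)

theorem Leads.loop {M : Program} {x : List Bool} {n b l : ℕ} {r : Reg} {f : MState → MState}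
    (hbody : ∀ s, Leads M x n b s (b + l) (f s)) (hr : ∀ s, (f s).v r = s.v r)
    (hdec : M[b + l]? = some (.sub r.phys r.phys 1))
    (htest : M[b + l + 1]? = some (.jpos r.phys b)) (m : ℕ) {s : MState} (hs : s.v r = m) :
    Leads M x (m * (n + 2) + 1) (b + l + 1) s (b + l + 2) ((countDown r f)^[m] s) := by
  induction m generalizing s with
  | zero => exact (Leads.jpos_of_eq_zero htest hs).mono (by omega)
  | succ m ih =>
    have hsub : Leads M x 1 (b + l) (f s) (b + l + 1) (countDown r f s) :=
      Instr.Effect.leads (Instr.effect_of_exec_eq_write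
        (fun c h => by rw [Instr.exec, h.scalar, h.one]) fun _ => rfl) hdec
    have hcount : (countDown r f s).v r = m := by simp [countDown, hr, hs]
    rw [Function.iterate_succ_apply]
    exact ((((Leads.jpos_of_pos htest (by omega)).trans (hbody s)).trans hsub).trans
      (ih hcount)).mono (by rw [Nat.succ_mul]; omega)

/-- Execute `f` as often as the universe has elements, with the register `r` as counter. -/
def repeatSize (r : Reg) (f : List Bool → MState → MState) (x : List Bool) (s : MState) : MState :=
  (countDown r (f x))^[univSize x] (s.set r (univSize x))

theorem Impl.repeatSize (r : Reg) {f : List Bool → MState → MState} (hf : Impl f)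
    (hr : ∀ x s, (f x s).v r = s.v r) : Impl (repeatSize r f) := by
  obtain ⟨p, l, code, hl, h⟩ := hf
  refine ⟨Polynomial.X * (p + Polynomial.C 2) + Polynomial.C 3, l + 4, fun a =>
    .add r.phys 3 5 :: .jpos 1 (a + 2 + l + 1) ::
      (code (a + 2) ++ [.sub r.phys r.phys 1, .jpos r.phys (a + 2)]),
    fun a => ⟨by simp [(hl _).1], ?_⟩, fun M a x hM s => ?_⟩
  · exact Program.QueryFree.append (M := [_, _]) (by simp [Program.QueryFree])
      ((hl _).2.append (by simp [Program.QueryFree]))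
  simp only [Program.contains_cons, Program.contains_append, (hl _).1] at hM
  obtain ⟨hsize, hgoto, hbody, hdec, htest, -⟩ := hM
  have hinit : Leads M x 1 a s (a + 1) (s.set r (univSize x)) :=
    Instr.Effect.leads (Instr.effect_of_exec_eq_write
      (fun c h => by rw [Instr.exec, h.size, h.zero, add_zero]) fun _ => rfl) hsize
  have hloop := Leads.loop (h M _ x hbody) (hr x) hdec htest (univSize x)
    (s := s.set r (univSize x)) (by simp)
  have hle := Nat.mul_le_mul_right (p.eval x.length + 2) (univSize_le x)
  simp only [Polynomial.eval_add, Polynomial.eval_mul, Polynomial.eval_X, Polynomial.eval_C]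
  have hend : a + (l + 4) = a + 2 + l + 2 := by omega
  rw [hend]
  exact ((hinit.trans (.goto hgoto _)).trans hloop).mono (by omega)

/-! ### The preamble -/

theorem inputSymbol_eq_one_iff (x : List Bool) (i : ℕ) :
    inputSymbol x i = 1 ↔ x[i]? = some true := by
  unfold inputSymbol
  split <;> simp_all

theorem inputSymbol_eq_one_iff_lt_univSize {x : List Bool} {i : ℕ} (hi : i ≤ univSize x) :
    inputSymbol x i = 1 ↔ i < univSize x := by
  rw [inputSymbol_eq_one_iff]
  induction x generalizing i with
  | nil => simp [univSize]
  | cons b x ih =>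
    cases b with
    | false =>
      have hsize : univSize (false :: x) = 0 := rfl
      rw [hsize] at hi ⊢
      obtain rfl := Nat.le_zero.1 hi
      simp
    | true =>
      have hsize : univSize (true :: x) = univSize x + 1 := rfl
      rw [hsize] at hi ⊢
      cases i with
      | zero => simp
      | succ i => rw [List.getElem?_cons_succ, ih (by omega), Nat.add_lt_add_iff_right]

/-- A program segment, to be placed at position `0`, that puts `1` into register `1` and the size
of the universe into register `3`. The loop at position `3` goes on as long as it reads the
symbol `1`, and ends at position `7` on the symbols `0` and `2`. -/
def preamble : Program :=
  [.const 1 1, .jpos 1 3, .add 3 3 1, .read 0 3, .sub (Reg.work 0).phys 0 1,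
    .jpos (Reg.work 0).phys 7, .jpos 0 2]

/-- The register contents during the loop of the preamble, after counting `k` leading ones. -/
structure Counting (k : ℕ) (c : Config) : Prop where
  one : c.reg 1 = 1
  count : c.reg 3 = k
  other : ∀ r, r ≠ 0 → r ≠ 1 → r ≠ 3 → r ≠ (Reg.work 0).phys → c.reg r = 0
  sol : c.sol = []

theorem Counting.jump {k : ℕ} {c : Config} (hc : Counting k c) (l : ℕ) :
    Counting k { c with pc := l } :=
  ⟨hc.one, hc.count, hc.other, hc.sol⟩

theorem Counting.write {k : ℕ} {c : Config} (hc : Counting k c) {r : ℕ}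
    (hr : r = 0 ∨ r = (Reg.work 0).phys) (v : ℕ) : Counting k (c.write r v) := by
  have hne : 1 ≠ r ∧ 3 ≠ r := by rcases hr with rfl | rfl <;> simp [Reg.phys]
  refine ⟨(Function.update_of_ne hne.1 _ _).trans hc.one,
    (Function.update_of_ne hne.2 _ _).trans hc.count, fun i h0 h1 h3 h9 => ?_, hc.sol⟩
  exact (Function.update_of_ne (by aesop) _ _).trans (hc.other i h0 h1 h3 h9)

section

variable {M : Program}

theorem getElem?_of_preamble_prefix (hM : preamble <+: M) {k : ℕ} {I : Instr}
    (hk : preamble[k]? = some I) : M[k]? = some I := by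
  obtain ⟨M', rfl⟩ := hM
  rw [List.getElem?_append_left (List.getElem?_eq_some_iff.1 hk).1, hk]

theorem Counting.read (hM : preamble <+: M) (x : List Bool) {k : ℕ} {c : Config}
    (hc : Counting k c) (hpc : c.pc = 3) :
    ∃ c', Runs M x 2 c [] c' ∧ c'.pc = 5 ∧ Counting k c' ∧ c'.reg 0 = inputSymbol x k ∧
      c'.reg (Reg.work 0).phys = inputSymbol x k - 1 := by
  have hread : Runs M x 1 c [] (c.write 0 (inputSymbol x k)) := by
    rw [← hc.count]
    exact .of_getElem? x (I := .read 0 3) (by rw [hpc]; exact getElem?_of_preamble_prefix hM rfl)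
  have hc₁ := hc.write (.inl rfl) (inputSymbol x k)
  have hsub : Runs M x 1 (c.write 0 (inputSymbol x k)) [] ((c.write 0 (inputSymbol x k)).write
      (Reg.work 0).phys (inputSymbol x k - 1)) := by
    have h := Runs.of_getElem? (M := M) (I := .sub (Reg.work 0).phys 0 1) x
      (c := c.write 0 (inputSymbol x k)) (by
        rw [Config.write, hpc]
        exact getElem?_of_preamble_prefix hM rfl)
    rwa [Instr.exec, hc₁.one] at h
  exact ⟨_, hread.trans hsub, by simp [Config.write, hpc], hc₁.write (.inr rfl) _,
    by simp [Config.write, Reg.phys], by simp [Config.write]⟩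

theorem Counting.succ (hM : preamble <+: M) {x : List Bool} {k : ℕ} (hk : k < univSize x)
    {c : Config} (hc : Counting k c) (hpc : c.pc = 3) :
    ∃ c', Runs M x 5 c [] c' ∧ c'.pc = 3 ∧ Counting (k + 1) c' := by
  obtain ⟨⟨pc, reg, query, sol⟩, hread, rfl, hc', h0, hwork⟩ := hc.read hM x hpc
  rw [(inputSymbol_eq_one_iff_lt_univSize hk.le).2 hk] at h0 hwork
  dsimp only at h0 hwork
  have htest := Runs.jpos (c := ⟨5, reg, query, sol⟩) x (getElem?_of_preamble_prefix hM rfl)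
  rw [if_neg (by simp [hwork])] at htest
  have hback := Runs.jpos (c := ⟨6, reg, query, sol⟩) x (getElem?_of_preamble_prefix hM rfl)
  rw [if_pos (by simp [h0])] at hback
  have hadd := Runs.of_getElem? (c := ⟨2, reg, query, sol⟩) x (getElem?_of_preamble_prefix hM rfl)
  refine ⟨_, ((hread.trans htest).trans hback).trans hadd, rfl, ⟨?_, ?_, fun r h0 h1 h3 h9 => ?_,
    hc'.sol⟩⟩
  · have h1 : reg 1 = 1 := hc'.one
    simp [Instr.exec, Config.write, h1]
  · have h1 : reg 1 = 1 := hc'.one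
    have h3 : reg 3 = k := hc'.count
    simp [Instr.exec, Config.write, h1, h3]
  · exact (Function.update_of_ne h3 _ _).trans (hc'.other r h0 h1 h3 h9)

theorem Counting.exit (hM : preamble <+: M) {x : List Bool} {c : Config}
    (hc : Counting (univSize x) c) (hpc : c.pc = 3) :
    ∃ T ≤ 4, ∃ c', Runs M x T c [] c' ∧ c'.pc = 7 ∧ Counting (univSize x) c' := by
  obtain ⟨⟨pc, reg, query, sol⟩, hread, rfl, hc', h0, hwork⟩ := hc.read hM x hpc
  have hone := (inputSymbol_eq_one_iff_lt_univSize (le_refl (univSize x))).not.2 (lt_irrefl _)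
  dsimp only at h0 hwork
  have htest := Runs.jpos (c := ⟨5, reg, query, sol⟩) x (getElem?_of_preamble_prefix hM rfl)
  by_cases hpos : 0 < reg (Reg.work 0).phys
  · rw [if_pos hpos] at htest
    exact ⟨3, by omega, _, hread.trans htest, rfl, hc'.jump 7⟩
  · rw [if_neg hpos] at htest
    have hend := Runs.jpos (c := ⟨6, reg, query, sol⟩) x (getElem?_of_preamble_prefix hM rfl)
    rw [if_neg (show ¬0 < reg 0 by omega)] at hend
    exact ⟨4, le_rfl, _, (hread.trans htest).trans hend, rfl, hc'.jump 7⟩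

theorem Counting.exists_runs (hM : preamble <+: M) {x : List Bool} {m k : ℕ}
    (hk : k + m = univSize x) {c : Config} (hc : Counting k c) (hpc : c.pc = 3) :
    ∃ T ≤ 5 * m + 4, ∃ c', Runs M x T c [] c' ∧ c'.pc = 7 ∧ Counting (univSize x) c' := by
  induction m generalizing k c with
  | zero =>
    obtain rfl : k = univSize x := hk
    exact hc.exit hM hpc
  | succ m ih =>
    have hlt : k < univSize x := by omega
    obtain ⟨c', hrun, hpc', hc'⟩ := hc.succ hM hlt hpc
    obtain ⟨T, hT, c'', hrun', hc''⟩ := ih (k := k + 1) (by omega) hc' hpc'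
    exact ⟨5 + T, by omega, c'', hrun.trans hrun', hc''⟩

end

theorem Counting.represents {x : List Bool} {c : Config} (hc : Counting (univSize x) c) :
    Represents x ⟨fun r => c.reg r.phys, Data.init⟩ c where
  one := hc.one
  size := hc.count
  zero := hc.other 5 (by decide) (by decide) (by decide) (by decide)
  scalar _ := rfl
  array q a := hc.other _ (cell_ne_phys q a .addr) (cell_ne_const q a).1 (cell_ne_const q a).2.1
    (cell_ne_phys q a (.work 0))
  sol := hc.sol

theorem exists_runs_preamble {M : Program} (hM : preamble <+: M) (x : List Bool) :
    ∃ T ≤ 5 * x.length + 6, ∃ c s, Runs M x T Config.init [] c ∧ c.pc = preamble.length ∧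
      Represents x s c ∧ s.data = Data.init ∧ s.env = 0 := by
  have hone := Runs.of_getElem? (c := Config.init) x (getElem?_of_preamble_prefix hM (k := 0) rfl)
  have hgoto := Runs.jpos (c := ⟨1, Function.update (fun _ => 0) 1 1, [], []⟩) x
    (getElem?_of_preamble_prefix hM rfl)
  have hc : Counting 0 ⟨3, Function.update (fun _ => 0) 1 1, [], []⟩ :=
    ⟨rfl, rfl, fun r _ h1 _ _ => by simp [h1], rfl⟩
  obtain ⟨T, hT, c, hrun, hpc, hc⟩ := hc.exists_runs hM (zero_add (univSize x)) rfl
  have hx := univSize_le x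
  refine ⟨1 + 1 + T, by omega, c, _, (hone.trans hgoto).trans hrun, hpc, hc.represents, rfl, ?_⟩
  funext y
  have hy := (Reg.var y).phys_ne_const
  exact hc.other _ (by simp [Reg.phys]) hy.1 hy.2.1 (Reg.phys_injective.ne (by simp))

theorem Impl.exists_enumerates {f : List Bool → MState → MState} (hf : Impl f)
    {F : List Bool → List (List Bool)}
    (hF : ∀ x s, s.data = Data.init → s.env = 0 → (f x s).data.outs = F x) :
    ∃ (M : Program) (p : Polynomial ℕ), ∀ x : List Bool,
      Enumerates M ∅ x (p.eval x.length) Config.init 0 (F x) := by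
  obtain ⟨p, l, code, hl, h⟩ := hf
  let M : Program := preamble ++ code preamble.length
  have hquery : M.QueryFree := .append (by simp [Program.QueryFree, preamble]) (hl _).2
  obtain ⟨b, hb⟩ := M.exists_constSize_le
  let P : Polynomial ℕ := p + 5 * Polynomial.X + Polynomial.C 6
  refine ⟨M, P * (1 + 2 * (Polynomial.C (b + 2) + P)) + 1, fun x => ?_⟩
  obtain ⟨T, hT, c, s, hrun, hpc, hs, hdata, henv⟩ :=
    exists_runs_preamble (List.prefix_append preamble _ : preamble <+: M) x
  have hcode : M.Contains preamble.length (code preamble.length) := by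
    simp [Program.Contains, M]
  obtain ⟨U, hU, ws, c', hrun', hpc', -, hout⟩ := h M _ x hcode s c hpc hs
  rw [hF x s hdata henv, hdata] at hout
  obtain rfl : F x = ws := hout
  have hhalt : M.fetch c' = .halt := by
    have hnone : M[c'.pc]? = none := by simp [M, hpc', (hl _).1]
    rw [Program.fetch, hnone, Option.getD_none]
  have hle : T + U ≤ P.eval x.length := by
    simp only [P, Polynomial.eval_add, Polynomial.eval_mul, Polynomial.eval_X, Polynomial.eval_C,
      Polynomial.eval_ofNat]
    omega
  refine (hrun.trans hrun').enumerates hquery hb hhalt (b := b + 2) (by omega) (by omega)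
    ⟨by simp [Config.init], rfl⟩ ?_
  simp only [Polynomial.eval_add, Polynomial.eval_mul, Polynomial.eval_C, Polynomial.eval_one,
    Polynomial.eval_ofNat, zero_add]
  gcongr

/-! ### A language of expressions and commands -/

/-- Expressions over the first-order variables, the input word and the arrays; `mulSize e` is the
product of `e` and the size of the universe. -/
inductive Expr : Type
  | const (a : ℕ)
  | var (y : ℕ)
  | input (e : Expr)
  | arr (q : ℕ) (e : Expr)
  | add (e e' : Expr)
  | sub (e e' : Expr)
  | mulSize (e : Expr)

/-- The value of an expression for the input word `x`, the arrays `A` and the values `u` of the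
first-order variables. -/
def Expr.eval (x : List Bool) (A : ℕ → ℕ → ℕ) (u : ℕ → ℕ) : Expr → ℕ
  | .const a => a
  | .var y => u y
  | .input e => inputSymbol x (e.eval x A u)
  | .arr q e => A q (e.eval x A u)
  | .add e e' => e.eval x A u + e'.eval x A u
  | .sub e e' => e.eval x A u - e'.eval x A u
  | .mulSize e => univSize x * e.eval x A u

/-- Commands. The loop `repeatSize c` executes `c` as often as the universe has elements, and
`forVar y c` executes `c` once for every element of the universe as the value of `y`. -/
inductive Cmd : Type
  | skip
  | seq (c c' : Cmd)
  | store (q : ℕ) (e e' : Expr)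
  | outBit (e : Expr)
  | output
  | ite (e : Expr) (c c' : Cmd)
  | repeatSize (c : Cmd)
  | forVar (y : ℕ) (c : Cmd)

/-- The effect of a command on the data, for the input word `x` and the values `u` of the
first-order variables. -/
def Cmd.run (x : List Bool) : Cmd → (ℕ → ℕ) → Data → Data
  | .skip, _, D => D
  | .seq c c', u, D => c'.run x u (c.run x u D)
  | .store q e e', u, D => D.setArr q (e.eval x D.arr u) (e'.eval x D.arr u)
  | .outBit e, u, D => D.writeBit (decide (0 < e.eval x D.arr u))
  | .output, _, D => D.output
  | .ite e c c', u, D => if 0 < e.eval x D.arr u then c.run x u D else c'.run x u D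
  | .repeatSize c, u, D => (c.run x u)^[univSize x] D
  | .forVar y c, u, D =>
    (List.range (univSize x)).foldl (fun D a => c.run x (Function.update u y a) D) D

/-! ### Compilation -/

/-- Both states have the same first-order variables and the same work registers `1, …, d`. The
work register `0` holds results of expressions. -/
structure Keeps (d : ℕ) (s s' : MState) : Prop where
  env_eq : s'.env = s.env
  work_eq : ∀ j, 0 < j → j ≤ d → s'.v (.work j) = s.v (.work j)

theorem Keeps.refl (d : ℕ) (s : MState) : Keeps d s s := ⟨rfl, fun _ _ _ => rfl⟩

theorem Keeps.trans {d : ℕ} {s s' s'' : MState} (h : Keeps d s s') (h' : Keeps d s' s'') :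
    Keeps d s s'' :=
  ⟨h'.env_eq.trans h.env_eq, fun j h0 hj => (h'.work_eq j h0 hj).trans (h.work_eq j h0 hj)⟩

theorem Keeps.mono {d e : ℕ} {s s' : MState} (h : Keeps e s s') (hd : d ≤ e) : Keeps d s s' :=
  ⟨h.env_eq, fun j h0 hj => h.work_eq j h0 (hj.trans hd)⟩

theorem MState.set_self (s : MState) (r : Reg) : s.set r (s.v r) = s := by simp [MState.set]

theorem Keeps.set_addr (d : ℕ) (s : MState) (a : ℕ) : Keeps d s (s.set .addr a) :=
  ⟨by funext y; simp [MState.env], fun j _ _ => by simp⟩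

theorem Keeps.set_result (d : ℕ) (s : MState) (a : ℕ) : Keeps d s (s.set (.work 0) a) :=
  ⟨by funext y; simp [MState.env], fun j h0 _ => by simp [h0.ne']⟩

theorem Keeps.set_work {d j : ℕ} (hj : d < j) (s : MState) (a : ℕ) :
    Keeps d s (s.set (.work j) a) :=
  ⟨by funext y; simp [MState.env], fun i _ hi => by simp [(hi.trans_lt hj).ne]⟩

theorem Keeps.set_var {d : ℕ} {s s' : MState} (h : Keeps d s s') (y a : ℕ) :
    Keeps d (s.set (.var y) a) (s'.set (.var y) a) :=
  ⟨by simp [h.env_eq], fun j h0 hj => by simp [h.work_eq j h0 hj]⟩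

/-- The state transformer `F` puts the value of the expression `e` into the work register `0` and
leaves the data, the variables and the work registers `1, …, d` alone. -/
structure Evaluates (d : ℕ) (e : Expr) (F : List Bool → MState → MState) : Prop where
  impl : Impl F
  data_eq : ∀ x s, (F x s).data = s.data
  keeps : ∀ x s, Keeps d s (F x s)
  result : ∀ x s, (F x s).v (.work 0) = e.eval x s.data.arr s.env

/-- The first value is kept in the work register `d + 1` while the second one is computed. -/
theorem Evaluates.exists_pair {d : ℕ} {e e' : Expr} {F F' : List Bool → MState → MState}
    (h : Evaluates d e F) (h' : Evaluates (d + 1) e' F') :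
    ∃ G, Impl G ∧ ∀ x s, (G x s).data = s.data ∧ Keeps d s (G x s) ∧
      (G x s).v (.work (d + 1)) = e.eval x s.data.arr s.env ∧
      (G x s).v (.work 0) = e'.eval x s.data.arr s.env := by
  refine ⟨_, h'.impl.comp ((Impl.move (.work (d + 1)) (.work 0)).comp h.impl), fun x s => ?_⟩
  set s' := (F x s).set (.work (d + 1)) ((F x s).v (.work 0)) with hs'
  have hkeep : Keeps d s s' := (h.keeps x s).trans (.set_work (by omega) _ _)
  have hdata : s'.data = s.data := h.data_eq x s
  refine ⟨(h'.data_eq x s').trans hdata, hkeep.trans ((h'.keeps x s').mono (by omega)), ?_, ?_⟩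
  · rw [(h'.keeps x s').work_eq _ (by omega) le_rfl, hs', MState.set_v, if_pos rfl, h.result]
  · rw [h'.result, hdata, hkeep.env_eq]

theorem Evaluates.exists_unary {d : ℕ} {e e' : Expr} {F G : List Bool → MState → MState}
    (h : Evaluates d e F) (hG : Impl G) (hdata : ∀ x s, (G x s).data = s.data)
    (hkeep : ∀ x s, Keeps d s (G x s))
    (hresult : ∀ x (s s' : MState), s'.data = s.data → s'.v (.work 0) = e.eval x s.data.arr s.env →
      (G x s').v (.work 0) = e'.eval x s.data.arr s.env) : ∃ H, Evaluates d e' H :=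
  ⟨_, hG.comp h.impl, fun x s => (hdata x _).trans (h.data_eq x s),
    fun x s => (h.keeps x s).trans (hkeep x _),
    fun x s => hresult x s _ (h.data_eq x s) (h.result x s)⟩

theorem repeatSize_induction {r : Reg} {f : List Bool → MState → MState} {x : List Bool}
    {s : MState} (P : ℕ → MState → Prop) (h0 : P 0 (s.set r (univSize x)))
    (hs : ∀ i t, P i t → P (i + 1) (countDown r (f x) t)) :
    P (univSize x) (repeatSize r f x s) := by
  have h : ∀ n, P n ((countDown r (f x))^[n] (s.set r (univSize x))) := by
    intro n
    induction n with
    | zero => exact h0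
    | succ n ih =>
      rw [Function.iterate_succ_apply']
      exact hs n _ ih
  exact h _

theorem exists_impl_mulSize (d : ℕ) :
    ∃ F, Impl F ∧ ∀ x s, (F x s).data = s.data ∧ Keeps d s (F x s) ∧
      (F x s).v (.work 0) = univSize x * s.v (.work 0) := by
  have hloop : Impl (repeatSize (.work (d + 2)) fun _ s =>
      s.set (.work 0) (s.v (.work 0) + s.v (.work (d + 1)))) :=
    (Impl.add (.work 0) (.work 0) (.work (d + 1))).repeatSize _ fun _ _ => by simp
  refine ⟨_, hloop.comp ((Impl.const (.work 0) 0).comp (Impl.move (.work (d + 1)) (.work 0))),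
    fun x s => ?_⟩
  let P : ℕ → MState → Prop := fun i t => t.data = s.data ∧ Keeps d s t ∧
    t.v (.work (d + 1)) = s.v (.work 0) ∧ t.v (.work 0) = i * s.v (.work 0)
  have hP := repeatSize_induction (r := .work (d + 2)) (x := x)
    (f := fun _ s => s.set (.work 0) (s.v (.work 0) + s.v (.work (d + 1))))
    (s := (s.set (.work (d + 1)) (s.v (.work 0))).set (.work 0) 0) P
    ⟨rfl, ((Keeps.set_work (by omega) _ _).trans (.set_result _ _ _)).trans
      (.set_work (by omega) _ _), by simp, by simp⟩
    fun i t ⟨hdata, hkeep, hsummand, hsum⟩ => ⟨hdata, (hkeep.trans (.set_result _ _ _)).trans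
      (.set_work (by omega) _ _), by simp [countDown, hsummand],
      by simp [countDown, hsummand, hsum, add_mul]⟩
  exact ⟨hP.1, hP.2.1, hP.2.2.2⟩

theorem Expr.exists_evaluates (e : Expr) (d : ℕ) : ∃ F, Evaluates d e F := by
  induction e generalizing d with
  | const a => exact ⟨_, .const (.work 0) a, fun _ _ => rfl, fun _ _ => .set_result _ _ _,
      fun _ _ => by simp [eval]⟩
  | var y => exact ⟨_, .move (.work 0) (.var y), fun _ _ => rfl, fun _ _ => .set_result _ _ _,
      fun _ _ => by simp [eval, MState.env]⟩
  | input e ih =>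
    obtain ⟨F, hF⟩ := ih d
    exact hF.exists_unary (.input (.work 0) (.work 0)) (fun _ _ => rfl)
      (fun _ _ => .set_result _ _ _) fun _ _ _ _ h => by simp [eval, h]
  | arr q e ih =>
    obtain ⟨F, hF⟩ := ih d
    exact hF.exists_unary (.load (.work 0) q (.work 0)) (fun _ _ => rfl)
      (fun _ _ => (Keeps.set_addr _ _ _).trans (.set_result _ _ _))
      fun _ _ _ hdata h => by simp [eval, h, hdata]
  | add e e' ih ih' =>
    obtain ⟨⟨F, hF⟩, F', hF'⟩ := And.intro (ih d) (ih' (d + 1))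
    obtain ⟨G, hG, h⟩ := hF.exists_pair hF'
    exact ⟨_, (Impl.add (.work 0) (.work (d + 1)) (.work 0)).comp hG, fun x s => (h x s).1,
      fun x s => (h x s).2.1.trans (.set_result _ _ _), fun x s => by simp [eval, h]⟩
  | sub e e' ih ih' =>
    obtain ⟨⟨F, hF⟩, F', hF'⟩ := And.intro (ih d) (ih' (d + 1))
    obtain ⟨G, hG, h⟩ := hF.exists_pair hF'
    exact ⟨_, (Impl.sub (.work 0) (.work (d + 1)) (.work 0)).comp hG, fun x s => (h x s).1,
      fun x s => (h x s).2.1.trans (.set_result _ _ _), fun x s => by simp [eval, h]⟩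
  | mulSize e ih =>
    obtain ⟨F, hF⟩ := ih d
    obtain ⟨G, hG, h⟩ := exists_impl_mulSize d
    exact hF.exists_unary hG (fun x s => (h x s).1) (fun x s => (h x s).2.1)
      fun x _ s' _ hs' => by rw [(h x s').2.2, hs', eval]

/-- The state transformer `F` has the effect of the command `c` on the data and leaves the
variables and the work registers `1, …, d` alone. -/
structure Executes (d : ℕ) (c : Cmd) (F : List Bool → MState → MState) : Prop where
  impl : Impl F
  data_eq : ∀ x s, (F x s).data = c.run x s.env s.data
  keeps : ∀ x s, Keeps d s (F x s)

theorem exists_executes_store (d q : ℕ) (e e' : Expr) : ∃ F, Executes d (.store q e e') F := by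
  obtain ⟨⟨F, hF⟩, F', hF'⟩ := And.intro (e.exists_evaluates d) (e'.exists_evaluates (d + 1))
  obtain ⟨G, hG, h⟩ := hF.exists_pair hF'
  refine ⟨_, (Impl.store q (i := .work (d + 1)) (j := .work 0) nofun).comp hG, fun x s => ?_,
    fun x s => (h x s).2.1.trans ?_⟩
  · simp only [Cmd.run, h]
  · exact ⟨(Keeps.set_addr d _ 0).env_eq, (Keeps.set_addr d _ 0).work_eq⟩

theorem Executes.exists_ite {d : ℕ} {c c' : Cmd} {F F' : List Bool → MState → MState} (e : Expr)
    (h : Executes d c F) (h' : Executes d c' F') : ∃ G, Executes d (.ite e c c') G := by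
  obtain ⟨E, hE⟩ := e.exists_evaluates d
  refine ⟨_, (Impl.ite (.work 0) h.impl h'.impl).comp hE.impl, fun x s => ?_, fun x s => ?_⟩
  · simp only [hE.result, Cmd.run]
    split <;> simp only [h.data_eq, h'.data_eq, hE.data_eq, (hE.keeps x s).env_eq]
  · split
    · exact (hE.keeps x s).trans (h.keeps x _)
    · exact (hE.keeps x s).trans (h'.keeps x _)

theorem Executes.exists_repeatSize {d : ℕ} {c : Cmd} {F : List Bool → MState → MState}
    (h : Executes (d + 1) c F) : ∃ G, Executes d (.repeatSize c) G := by
  have hloop := h.impl.repeatSize (.work (d + 1)) fun x s =>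
    (h.keeps x s).work_eq _ (by omega) le_rfl
  have hinv x s := repeatSize_induction (r := .work (d + 1)) (f := F) (x := x) (s := s)
    (fun i t => t.data = (c.run x s.env)^[i] s.data ∧ Keeps d s t)
    ⟨rfl, .set_work (by omega) _ _⟩ fun i t ⟨hdata, hkeep⟩ => ⟨by
      rw [countDown, MState.set_data, h.data_eq, hdata, hkeep.env_eq,
        ← Function.iterate_succ_apply' (c.run x s.env)],
      (hkeep.trans ((h.keeps x t).mono (by omega))).trans (.set_work (by omega) _ _)⟩
  exact ⟨_, hloop, fun x s => (hinv x s).1, fun x s => (hinv x s).2⟩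

/-- The old value of `y` is kept in the work register `d + 1`, and `d + 2` is the counter. -/
theorem Executes.exists_forVar {d : ℕ} {c : Cmd} {F : List Bool → MState → MState} (y : ℕ)
    (h : Executes (d + 2) c F) : ∃ G, Executes d (.forVar y c) G := by
  let body : List Bool → MState → MState := fun x s =>
    (F x s).set (.var y) ((F x s).v (.var y) + 1)
  have hloop : Impl (repeatSize (.work (d + 2)) body) :=
    ((Impl.addOne (.var y) (.var y)).comp h.impl).repeatSize _ fun x s => by
      simpa using (h.keeps x s).work_eq (d + 2) (by omega) le_rfl
  let start (s : MState) : MState := s.set (.work (d + 1)) (s.v (.var y))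
  have hstart s : Keeps d s (start s) := .set_work (by omega) _ _
  have hinv x s := repeatSize_induction (r := .work (d + 2)) (f := body) (x := x)
    (s := (start s).set (.var y) 0)
    (fun i t => t.data = (List.range i).foldl
      (fun D a => c.run x (Function.update s.env y a) D) s.data ∧
      Keeps (d + 1) ((start s).set (.var y) i) t)
    ⟨rfl, .set_work (by omega) _ _⟩ fun i t ⟨hdata, hkeep⟩ => by
      have hbody := hkeep.trans ((h.keeps x t).mono (by omega))
      have henv : t.env = Function.update s.env y i := by
        rw [hkeep.env_eq, MState.env_set_var, (hstart s).env_eq]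
      have hy : (F x t).v (.var y) = i := by
        simpa [MState.env] using congrFun hbody.env_eq y
      have hnext : body x t = (F x t).set (.var y) (i + 1) := by simp only [body, hy]
      refine ⟨?_, ?_⟩
      · rw [List.range_succ, List.foldl_append, List.foldl_cons, List.foldl_nil, ← hdata, ← henv]
        exact h.data_eq x t
      · have hset := hbody.set_var y (i + 1)
        rw [MState.set_set, ← hnext] at hset
        exact hset.trans (.set_work (Nat.lt_succ_self _) _ _)
  refine ⟨_, (Impl.move (.var y) (.work (d + 1))).comp (hloop.comp
    ((Impl.const (.var y) 0).comp (Impl.move (.work (d + 1)) (.var y)))),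
    fun x s => (hinv x s).1, fun x s => (hstart s).trans ?_⟩
  have hsaved := (hinv x s).2.work_eq (d + 1) (by omega) le_rfl
  have hend := ((hinv x s).2.set_var y ((start s).v (.var y))).mono d.le_succ
  rw [MState.set_set, MState.set_self] at hend
  simp only [MState.set_v, start] at hsaved
  simpa [start, hsaved, body] using hend

theorem Cmd.exists_executes (c : Cmd) (d : ℕ) : ∃ F, Executes d c F := by
  induction c generalizing d with
  | skip => exact ⟨_, .id, fun _ _ => rfl, fun _ _ => .refl _ _⟩
  | seq c c' ih ih' =>
    obtain ⟨⟨F, hF⟩, F', hF'⟩ := And.intro (ih d) (ih' d)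
    exact ⟨_, hF'.impl.comp hF.impl,
      fun x s => by rw [hF'.data_eq, hF.data_eq, (hF.keeps x s).env_eq, run],
      fun x s => (hF.keeps x s).trans (hF'.keeps x _)⟩
  | store q e e' => exact exists_executes_store d q e e'
  | outBit e =>
    obtain ⟨E, hE⟩ := e.exists_evaluates d
    exact ⟨_, (Impl.outBit (.work 0)).comp hE.impl,
      fun x s => by simp only [hE.data_eq, hE.result, run], fun x s =>
        ⟨(hE.keeps x s).env_eq, (hE.keeps x s).work_eq⟩⟩
  | output => exact ⟨_, .output, fun _ _ => rfl, fun _ _ => ⟨rfl, fun _ _ _ => rfl⟩⟩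
  | ite e c c' ih ih' =>
    obtain ⟨⟨F, hF⟩, F', hF'⟩ := And.intro (ih d) (ih' d)
    exact hF.exists_ite e hF'
  | repeatSize c ih =>
    obtain ⟨F, hF⟩ := ih (d + 1)
    exact hF.exists_repeatSize
  | forVar y c ih =>
    obtain ⟨F, hF⟩ := ih (d + 2)
    exact hF.exists_forVar y

theorem Cmd.exists_enumerates (c : Cmd) :
    ∃ (M : Program) (p : Polynomial ℕ), ∀ x : List Bool,
      Enumerates M ∅ x (p.eval x.length) Config.init 0 (c.run x 0 Data.init).outs := by
  obtain ⟨F, hF⟩ := c.exists_executes 0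
  exact hF.impl.exists_enumerates fun x s hdata henv => by rw [hF.data_eq, hdata, henv]

/-! ### Loops over tuples -/

/-- The position in a characteristic word of the tuple of values of the variables in `l`. -/
def tupleIdx (n : ℕ) (l : List ℕ) (u : ℕ → ℕ) : ℕ := Nat.ofDigits n (l.map u)

/-- All ways to change the values of the variables in `l` to numbers below `n`, the first variable
changing fastest. -/
def envs (n : ℕ) : List ℕ → (ℕ → ℕ) → List (ℕ → ℕ)
  | [], u => [u]
  | v :: l, u => (envs n l u).flatMap fun u' => (List.range n).map (Function.update u' v)

theorem tupleIdx_cons (n v : ℕ) (l : List ℕ) (u : ℕ → ℕ) :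
    tupleIdx n (v :: l) u = u v + n * tupleIdx n l u :=
  Nat.ofDigits_cons

theorem tupleIdx_update_of_notMem (n : ℕ) {v : ℕ} {l : List ℕ} (hv : v ∉ l) (u : ℕ → ℕ) (a : ℕ) :
    tupleIdx n l (Function.update u v a) = tupleIdx n l u := by
  unfold tupleIdx
  congr 1
  exact List.map_congr_left fun w hw => Function.update_of_ne (ne_of_mem_of_not_mem hw hv) _ _

theorem flatMap_range_map_add_mul (n m : ℕ) :
    ((List.range m).flatMap fun i => (List.range n).map (· + n * i)) = List.range (n * m) := by
  induction m with
  | zero => simp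
  | succ m ih =>
    rw [List.range_succ, List.flatMap_append, ih, Nat.mul_succ, List.range_add]
    simp [add_comm]

theorem map_tupleIdx_envs (n : ℕ) {l : List ℕ} (hl : l.Nodup) (u : ℕ → ℕ) :
    (envs n l u).map (tupleIdx n l) = List.range (n ^ l.length) := by
  induction l with
  | nil => simp [envs, tupleIdx]
  | cons v l ih =>
    obtain ⟨hv, hl⟩ := List.nodup_cons.1 hl
    rw [List.length_cons, pow_succ', ← flatMap_range_map_add_mul, ← ih hl, List.flatMap_map, envs,
      List.map_flatMap]
    simp only [List.map_map, Function.comp_def, tupleIdx_cons, Function.update_self,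
      tupleIdx_update_of_notMem n hv]

theorem exists_mem_envs_tupleIdx_eq {n : ℕ} {l : List ℕ} (hl : l.Nodup) (u : ℕ → ℕ) {a : ℕ}
    (ha : a < n ^ l.length) : ∃ u' ∈ envs n l u, tupleIdx n l u' = a := by
  rwa [← List.mem_range, ← map_tupleIdx_envs n hl u, List.mem_map] at ha

theorem injOn_tupleIdx_envs {n : ℕ} {l : List ℕ} (hl : l.Nodup) (u : ℕ → ℕ) :
    Set.InjOn (tupleIdx n l) {u' | u' ∈ envs n l u} := by
  have h := List.nodup_range (n := n ^ l.length)
  rw [← map_tupleIdx_envs n hl u] at h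
  exact fun _ h₁ _ h₂ => List.inj_on_of_nodup_map h h₁ h₂

theorem mem_envs {n : ℕ} {l : List ℕ} {u u' : ℕ → ℕ} (hl : l.Nodup) :
    u' ∈ envs n l u ↔ (∀ v ∈ l, u' v < n) ∧ ∀ v ∉ l, u' v = u v := by
  induction l generalizing u' with
  | nil => simp [envs, funext_iff]
  | cons y l ih =>
    obtain ⟨hy, hl⟩ := List.nodup_cons.1 hl
    rw [List.forall_mem_cons]
    simp only [envs, List.mem_flatMap, List.mem_map, List.mem_range, ih hl, List.mem_cons, not_or]
    constructor
    · rintro ⟨w, ⟨hw, hwu⟩, a, ha, rfl⟩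
      refine ⟨⟨by simpa using ha, fun v hv => ?_⟩, fun v hv => ?_⟩
      · simpa [ne_of_mem_of_not_mem hv hy] using hw v hv
      · simpa [hv.1] using hwu v hv.2
    · rintro ⟨⟨hy', hw⟩, hwu⟩
      refine ⟨Function.update u' y (u y), ⟨fun v hv => ?_, fun v hv => ?_⟩, u' y, hy', by simp⟩
      · simpa [ne_of_mem_of_not_mem hv hy] using hw v hv
      · by_cases hvy : v = y
        · simp [hvy]
        · simpa [hvy] using hwu v ⟨hvy, hv⟩

/-- The position of the tuple of values of the variables in `l`. -/
def Expr.tuple : List ℕ → Expr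
  | [] => .const 0
  | v :: l => .add (.var v) (.mulSize (tuple l))

@[simp] theorem Expr.eval_tuple (x : List Bool) (A : ℕ → ℕ → ℕ) (u : ℕ → ℕ) (l : List ℕ) :
    (Expr.tuple l).eval x A u = tupleIdx (univSize x) l u := by
  induction l with
  | nil => rfl
  | cons v l ih => rw [tuple, eval, eval, eval, ih, tupleIdx_cons]

/-- Execute `c` once for every choice of values of the variables in `l`. -/
def Cmd.forAll : List ℕ → Cmd → Cmd
  | [], c => c
  | v :: l, c => forAll l (.forVar v c)

theorem Cmd.run_forAll (x : List Bool) (l : List ℕ) (c : Cmd) (u : ℕ → ℕ) (D : Data) :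
    (Cmd.forAll l c).run x u D = (envs (univSize x) l u).foldl (fun D u' => c.run x u' D) D := by
  induction l generalizing c with
  | nil => rfl
  | cons v l ih => simp only [forAll, ih, run, envs, List.foldl_flatMap, List.foldl_map]

/-- Execute `c` as often as there are `k`-tuples over the universe. -/
def Cmd.repeatPow : ℕ → Cmd → Cmd
  | 0, c => c
  | k + 1, c => .repeatSize (repeatPow k c)

theorem Cmd.run_repeatPow (x : List Bool) (k : ℕ) (c : Cmd) (u : ℕ → ℕ) :
    (Cmd.repeatPow k c).run x u = (c.run x u)^[univSize x ^ k] := by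
  induction k with
  | zero => simp [repeatPow]
  | succ k ih =>
    funext D
    rw [repeatPow, run, ih, ← Function.iterate_mul, pow_succ]

/-! ### Setting entries of an array -/

/-- Replace the array `q`. -/
def Data.putArr (D : Data) (q : ℕ) (A : ℕ → ℕ) : Data := { D with arr := Function.update D.arr q A }

theorem Data.putArr_self (D : Data) (q : ℕ) : D.putArr q (D.arr q) = D := by simp [putArr]

theorem Data.putArr_putArr (D : Data) (q : ℕ) (A A' : ℕ → ℕ) :
    (D.putArr q A).putArr q A' = D.putArr q A' := by
  simp [putArr]

@[simp] theorem Data.putArr_arr_self (D : Data) (q : ℕ) (A : ℕ → ℕ) : (D.putArr q A).arr q = A := by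
  simp [putArr]

/-- The value of the expression does not depend on the array `q`. -/
def Expr.Ignores (e : Expr) (q : ℕ) : Prop :=
  ∀ x A u B, e.eval x (Function.update A q B) u = e.eval x A u

/-- The test whether `e` is zero. -/
def Expr.not (e : Expr) : Expr := .sub (.const 1) e

theorem Expr.not_pos_iff {x : List Bool} {A : ℕ → ℕ → ℕ} {u : ℕ → ℕ} {e : Expr} :
    0 < e.not.eval x A u ↔ ¬0 < e.eval x A u := by
  rw [not, eval, eval]
  omega

theorem Expr.Ignores.not {e : Expr} {q : ℕ} (he : e.Ignores q) : e.not.Ignores q :=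
  fun x A u B => congrArg (1 - ·) (he x A u B)

/-- Store `b` in the array `q` at the positions of the tuples of values of `l'`, for all values of
the variables in `l` that make `e` positive. -/
def Cmd.scatter (q b : ℕ) (l l' : List ℕ) (e : Expr) : Cmd :=
  .forAll l (.ite e (.store q (.tuple l') (.const b)) .skip)

open Classical in
theorem Cmd.run_scatter {q : ℕ} {e : Expr} (he : e.Ignores q) (b : ℕ) (l l' : List ℕ)
    (x : List Bool) (u : ℕ → ℕ) (D : Data) :
    (Cmd.scatter q b l l' e).run x u D = D.putArr q fun a =>
      if ∃ u' ∈ envs (univSize x) l u, tupleIdx (univSize x) l' u' = a ∧ 0 < e.eval x D.arr u'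
      then b else D.arr q a := by
  rw [scatter, run_forAll]
  induction envs (univSize x) l u generalizing D with
  | nil => simp [Data.putArr_self]
  | cons w L ih =>
    rw [List.foldl_cons, ih]
    by_cases hw : 0 < e.eval x D.arr w
    · have hrun : (Cmd.ite e (.store q (.tuple l') (.const b)) .skip).run x w D =
          D.putArr q (Function.update (D.arr q) (tupleIdx (univSize x) l' w) b) := by
        simp only [run, if_pos hw, Expr.eval_tuple, Expr.eval]
        rfl
      rw [hrun, Data.putArr_putArr, Data.putArr_arr_self]
      congr 1
      funext a
      simp only [Data.putArr, he x D.arr, List.mem_cons, exists_eq_or_imp, hw, and_true,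
        Function.update_apply]
      rcases eq_or_ne a (tupleIdx (univSize x) l' w) with rfl | ha
      · simp
      · simp [ha, ha.symm]
    · simp [run, hw]

/-- Set the first `n ^ k` entries of the array `q` to zero, `n` being the size of the universe. -/
def Cmd.clear (q k : ℕ) : Cmd := .scatter q 0 (List.range k) (List.range k) (.const 1)

theorem Cmd.exists_run_clear (q k : ℕ) (x : List Bool) (u : ℕ → ℕ) (D : Data) :
    ∃ A, (Cmd.clear q k).run x u D = D.putArr q A ∧ ∀ a < univSize x ^ k, A a = 0 := by
  refine ⟨_, run_scatter (fun _ _ _ _ => rfl) _ _ _ _ _ _, fun a ha => if_pos ?_⟩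
  obtain ⟨u', hu', rfl⟩ := exists_mem_envs_tupleIdx_eq (n := univSize x)
    (List.nodup_range (n := k)) u (a := a) (by simpa using ha)
  exact ⟨u', hu', rfl, one_pos⟩

/-- Make the array `q` the characteristic function of the set of the tuples of values of `l'`, for
all values of the variables in `l` that make `e` positive. -/
def Cmd.project (q : ℕ) (l l' : List ℕ) (e : Expr) : Cmd :=
  .seq (.clear q l'.length) (.scatter q 1 l l' e)

theorem Cmd.exists_run_project {q : ℕ} {e : Expr} (he : e.Ignores q) (l l' : List ℕ)
    (x : List Bool) (u : ℕ → ℕ) (D : Data) :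
    ∃ A, (Cmd.project q l l' e).run x u D = D.putArr q A ∧ ∀ a < univSize x ^ l'.length,
      (0 < A a ↔ ∃ u' ∈ envs (univSize x) l u,
        tupleIdx (univSize x) l' u' = a ∧ 0 < e.eval x D.arr u') := by
  obtain ⟨A, hrun, hA⟩ := exists_run_clear q l'.length x u D
  refine ⟨_, by rw [project, run, run_scatter he, hrun, Data.putArr_putArr], fun a ha => ?_⟩
  simp only [Data.putArr, he x D.arr, Function.update_self, hA a ha]
  split_ifs with h <;> simp [h]

/-- Delete from the set of tuples of values of `l`, given by its characteristic function in the
array `q`, those for which `e` is zero. -/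
def Cmd.filter (q : ℕ) (l : List ℕ) (e : Expr) : Cmd := .scatter q 0 l l e.not

theorem Cmd.exists_run_filter {q : ℕ} {e : Expr} (he : e.Ignores q) {l : List ℕ} (hl : l.Nodup)
    (x : List Bool) (u : ℕ → ℕ) (D : Data) :
    ∃ A, (Cmd.filter q l e).run x u D = D.putArr q A ∧ ∀ u' ∈ envs (univSize x) l u,
      (0 < A (tupleIdx (univSize x) l u') ↔
        0 < D.arr q (tupleIdx (univSize x) l u') ∧ 0 < e.eval x D.arr u') := by
  refine ⟨_, run_scatter he.not _ _ _ _ _ _, fun u' hu' => ?_⟩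
  have hiff : (∃ w ∈ envs (univSize x) l u, tupleIdx (univSize x) l w =
      tupleIdx (univSize x) l u' ∧ 0 < e.not.eval x D.arr w) ↔ ¬0 < e.eval x D.arr u' := by
    simp only [Expr.not_pos_iff]
    refine ⟨?_, fun h => ⟨u', hu', rfl, h⟩⟩
    rintro ⟨w, hw, hidx, hpos⟩
    rwa [← injOn_tupleIdx_envs hl u hw hu' hidx]
  simp only [hiff]
  split_ifs with h <;> simp_all

/-! ### Teams in arrays -/

theorem tupleIdx_lt {n : ℕ} {l : List ℕ} {u : ℕ → ℕ} (hu : ∀ v ∈ l, u v < n) :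
    tupleIdx n l u < n ^ l.length := by
  induction l with
  | nil => simp [tupleIdx]
  | cons v l ih =>
    rw [List.forall_mem_cons] at hu
    rw [tupleIdx_cons, List.length_cons, pow_succ']
    calc u v + n * tupleIdx n l u < n * (tupleIdx n l u + 1) := by linarith [hu.1]
      _ ≤ n * n ^ l.length := Nat.mul_le_mul_left n (ih hu.2)

theorem tupleIdx_eq_iff {n : ℕ} {l l' : List ℕ} {u u' : ℕ → ℕ} (hl : l.length = l'.length)
    (hu : ∀ v ∈ l, u v < n) (hu' : ∀ v ∈ l', u' v < n) :
    tupleIdx n l u = tupleIdx n l' u' ↔ l.map u = l'.map u' := by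
  refine ⟨fun h => ?_, fun h => by rw [tupleIdx, h, tupleIdx]⟩
  induction l generalizing l' with
  | nil => rw [List.length_eq_zero_iff.1 hl.symm]; rfl
  | cons v l ih =>
    obtain ⟨v', l', rfl⟩ := List.exists_cons_of_length_eq_add_one hl.symm
    rw [List.forall_mem_cons] at hu hu'
    rw [tupleIdx_cons, tupleIdx_cons] at h
    have hhead : u v = u' v' := by
      simpa [Nat.add_mul_mod_self_left, Nat.mod_eq_of_lt, hu.1, hu'.1] using congrArg (· % n) h
    rw [hhead, Nat.add_left_cancel_iff] at h
    rw [List.map_cons, List.map_cons, hhead, ih (by simpa using hl) hu.2 hu'.2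
      (Nat.eq_of_mul_eq_mul_left (by omega) h)]

theorem tupleIdx_ofFn {n k : ℕ} {x : Fin k → ℕ} {u : ℕ → ℕ} {a : Fin k → Fin n}
    (h : ∀ j, u (x j) = a j) : tupleIdx n (List.ofFn x) u = finFunctionFinEquiv a := by
  rw [finFunctionFinEquiv_apply]
  induction k with
  | zero => rfl
  | succ k ih =>
    rw [List.ofFn_succ, tupleIdx_cons, ih (a := fun j => a j.succ) fun j => h j.succ, h,
      Fin.sum_univ_succ, Finset.mul_sum]
    simp [pow_succ', mul_left_comm]

/-- The values of an assignment, being `0` outside of its domain. -/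
def Assignment.val {n : ℕ} (s : Assignment (Fin n)) (v : ℕ) : ℕ := (s v).elim 0 Fin.val

theorem Assignment.val_of_eq_some {n : ℕ} {s : Assignment (Fin n)} {v : ℕ} {a : Fin n}
    (h : s v = some a) : s.val v = a := by simp [Assignment.val, h]

section fullTeam

variable {n : ℕ} {D : Finset ℕ} {s : Assignment (Fin n)}

theorem exists_eq_some_of_mem_fullTeam {A : Type} {s : Assignment A} (hs : s ∈ fullTeam D A)
    {v : ℕ} (hv : v ∈ D) : ∃ a, s v = some a :=
  Option.ne_none_iff_exists'.1 ((hs v).2 hv)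

theorem eq_none_of_mem_fullTeam {A : Type} {s : Assignment A} (hs : s ∈ fullTeam D A) {v : ℕ}
    (hv : v ∉ D) : s v = none :=
  not_not.1 (mt (hs v).1 hv)

theorem val_lt_of_mem_fullTeam (hs : s ∈ fullTeam D (Fin n)) {v : ℕ} (hv : v ∈ D) :
    s.val v < n := by
  obtain ⟨a, ha⟩ := exists_eq_some_of_mem_fullTeam hs hv
  rw [Assignment.val_of_eq_some ha]
  exact a.2

theorem val_eq_val_iff {E : Finset ℕ} {t : Assignment (Fin n)} (hs : s ∈ fullTeam D (Fin n))
    (ht : t ∈ fullTeam E (Fin n)) {x y : ℕ} (hx : x ∈ D) (hy : y ∈ E) :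
    s.val x = t.val y ↔ s x = t y := by
  obtain ⟨a, ha⟩ := exists_eq_some_of_mem_fullTeam hs hx
  obtain ⟨b, hb⟩ := exists_eq_some_of_mem_fullTeam ht hy
  rw [Assignment.val_of_eq_some ha, Assignment.val_of_eq_some hb, ha, hb, Option.some_inj,
    Fin.ext_iff]

theorem map_val_sort_eq_iff {E E' : Finset ℕ} {t : Assignment (Fin n)}
    (hs : s ∈ fullTeam D (Fin n)) (ht : t ∈ fullTeam E (Fin n)) (hD : E' ⊆ D) (hE : E' ⊆ E) :
    E'.sort.map s.val = E'.sort.map t.val ↔ ∀ v ∈ E', s v = t v := by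
  simp only [List.map_inj_left, Finset.mem_sort]
  exact forall₂_congr fun v hv => val_eq_val_iff hs ht (hD hv) (hE hv)

theorem map_val_ofFn_eq_iff {E : Finset ℕ} {t : Assignment (Fin n)} (hs : s ∈ fullTeam D (Fin n))
    (ht : t ∈ fullTeam E (Fin n)) {m : ℕ} {x y : Fin m → ℕ} (hx : ∀ j, x j ∈ D)
    (hy : ∀ j, y j ∈ E) :
    (List.ofFn x).map s.val = (List.ofFn y).map t.val ↔ ∀ j, s (x j) = t (y j) := by
  rw [List.map_ofFn, List.map_ofFn, List.ofFn_inj, funext_iff]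
  exact forall_congr' fun j => val_eq_val_iff hs ht (hx j) (hy j)

theorem val_mem_envs (hs : s ∈ fullTeam D (Fin n)) : s.val ∈ envs n D.sort 0 := by
  refine (mem_envs (D.sort_nodup _)).2 ⟨fun v hv => ?_, fun v hv => ?_⟩
  · exact val_lt_of_mem_fullTeam hs ((D.mem_sort _).1 hv)
  · simp [Assignment.val, eq_none_of_mem_fullTeam hs (mt (D.mem_sort _).2 hv)]

theorem exists_val_eq_of_mem_envs {u : ℕ → ℕ} (hu : u ∈ envs n D.sort 0) :
    ∃ s ∈ fullTeam D (Fin n), s.val = u := by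
  simp only [mem_envs (D.sort_nodup _), Finset.mem_sort] at hu
  refine ⟨fun v => if h : v ∈ D then some ⟨u v, hu.1 v h⟩ else none, fun v => by simp,
    funext fun v => ?_⟩
  by_cases hv : v ∈ D
  · simp [Assignment.val, hv]
  · simp [Assignment.val, hv, hu.2 v hv]

theorem tupleIdx_val_mem_Iio (hs : s ∈ fullTeam D (Fin n)) :
    tupleIdx n D.sort s.val ∈ Set.Iio (n ^ D.card) := by
  rw [← D.length_sort (· ≤ ·)]
  exact tupleIdx_lt ((mem_envs (D.sort_nodup _)).1 (val_mem_envs hs)).1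

theorem injOn_tupleIdx_val :
    Set.InjOn (fun s : Assignment (Fin n) => tupleIdx n D.sort s.val) (fullTeam D (Fin n)) := by
  intro s hs t ht h
  have hval : s.val = t.val :=
    injOn_tupleIdx_envs (D.sort_nodup _) 0 (val_mem_envs hs) (val_mem_envs ht) h
  funext v
  by_cases hv : v ∈ D
  · exact (val_eq_val_iff hs ht hv hv).1 (congrFun hval v)
  · rw [eq_none_of_mem_fullTeam hs hv, eq_none_of_mem_fullTeam ht hv]

theorem finite_fullTeam (D : Finset ℕ) (n : ℕ) : (fullTeam D (Fin n)).Finite :=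
  .of_injOn (fun _ => tupleIdx_val_mem_Iio) injOn_tupleIdx_val (Set.finite_Iio _)

theorem ncard_fullTeam_le (D : Finset ℕ) (n : ℕ) : (fullTeam D (Fin n)).ncard ≤ n ^ D.card := by
  simpa using Set.ncard_le_ncard_of_injOn _ (fun _ => tupleIdx_val_mem_Iio) injOn_tupleIdx_val
    (Set.finite_Iio (n ^ D.card))

end fullTeam

/-- The team with domain `D` whose characteristic word is stored in the array `A`. -/
def storedTeam (n : ℕ) (D : Finset ℕ) (A : ℕ → ℕ) : Set (Assignment (Fin n)) :=
  {s | s ∈ fullTeam D (Fin n) ∧ 0 < A (tupleIdx n D.sort s.val)}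

theorem storedTeam_subset (n : ℕ) (D : Finset ℕ) (A : ℕ → ℕ) :
    storedTeam n D A ⊆ fullTeam D (Fin n) := fun _ h => h.1

/-- The test whether the current values form a member of the team with domain `D` in the array
`q`. -/
def Expr.member (q : ℕ) (D : Finset ℕ) : Expr := .arr q (.tuple D.sort)

/-- Make the array `q` the team with domain `D` of the assignments that make `e` positive. -/
def Cmd.assign (q : ℕ) (D : Finset ℕ) (e : Expr) : Cmd := .project q D.sort D.sort e

theorem Expr.ignores_arr_tuple {q r : ℕ} (h : r ≠ q) (l : List ℕ) :
    (Expr.arr r (.tuple l)).Ignores q :=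
  fun x A u B => by simp [eval, h]

theorem Expr.ignores_member {q r : ℕ} (h : r ≠ q) (D : Finset ℕ) : (Expr.member r D).Ignores q :=
  ignores_arr_tuple h _

section teamCommands

variable {x : List Bool} {n : ℕ} (hn : univSize x = n)
include hn

theorem member_pos_iff {D : Finset ℕ} {s : Assignment (Fin n)} (hs : s ∈ fullTeam D (Fin n))
    (q : ℕ) (A : ℕ → ℕ → ℕ) :
    0 < (Expr.member q D).eval x A s.val ↔ s ∈ storedTeam n D (A q) := by
  subst hn
  simp [Expr.member, Expr.eval, storedTeam, hs]

theorem exists_run_filter_storedTeam {q : ℕ} {e : Expr} (he : e.Ignores q) (D : Finset ℕ)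
    (d : Data) :
    ∃ A, (Cmd.filter q D.sort e).run x 0 d = d.putArr q A ∧
      storedTeam n D A = {s | s ∈ storedTeam n D (d.arr q) ∧ 0 < e.eval x d.arr s.val} := by
  subst hn
  obtain ⟨A, hrun, hA⟩ := Cmd.exists_run_filter he (D.sort_nodup (· ≤ ·)) x 0 d
  refine ⟨A, hrun, Set.ext fun s => ?_⟩
  simp only [storedTeam, Set.mem_ofPred_eq, and_assoc]
  exact and_congr_right fun hs => hA _ (val_mem_envs hs)

theorem exists_run_project_team {r : ℕ} {e : Expr} (he : e.Ignores r) {E : Finset ℕ} {l' : List ℕ}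
    (hl' : ∀ v ∈ l', v ∈ E) (d : Data) :
    ∃ A, (Cmd.project r E.sort l' e).run x 0 d = d.putArr r A ∧
      ∀ {D : Finset ℕ} {l : List ℕ}, (∀ v ∈ l, v ∈ D) → l.length = l'.length →
        ∀ s ∈ fullTeam D (Fin n), 0 < A (tupleIdx n l s.val) ↔
          ∃ t ∈ fullTeam E (Fin n), 0 < e.eval x d.arr t.val ∧ l.map s.val = l'.map t.val := by
  subst hn
  obtain ⟨A, hrun, hA⟩ := Cmd.exists_run_project he E.sort l' x 0 d
  refine ⟨A, hrun, fun {D l} hl hlen s hs => ?_⟩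
  have hsl : ∀ v ∈ l, s.val v < univSize x := fun v hv => val_lt_of_mem_fullTeam hs (hl v hv)
  have hidx {t : Assignment (Fin (univSize x))} (ht : t ∈ fullTeam E (Fin (univSize x))) :
      tupleIdx (univSize x) l' t.val = tupleIdx (univSize x) l s.val ↔
        l.map s.val = l'.map t.val :=
    (tupleIdx_eq_iff hlen.symm (fun v hv => val_lt_of_mem_fullTeam ht (hl' v hv)) hsl).trans eq_comm
  rw [hA _ (hlen ▸ tupleIdx_lt hsl)]
  constructor
  · rintro ⟨u, hu, heq, hpos⟩
    obtain ⟨t, ht, rfl⟩ := exists_val_eq_of_mem_envs hu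
    exact ⟨t, ht, hpos, (hidx ht).1 heq⟩
  · rintro ⟨t, ht, hpos, heq⟩
    exact ⟨t.val, val_mem_envs ht, (hidx ht).2 heq, hpos⟩

theorem exists_run_assign {q : ℕ} {e : Expr} (he : e.Ignores q) (D : Finset ℕ)
    (d : Data) :
    ∃ A, (Cmd.assign q D e).run x 0 d = d.putArr q A ∧
      storedTeam n D A = {s | s ∈ fullTeam D (Fin n) ∧ 0 < e.eval x d.arr s.val} := by
  obtain ⟨A, hrun, hA⟩ := exists_run_project_team hn he (fun v => (D.mem_sort (· ≤ ·)).1) d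
  refine ⟨A, hrun, Set.ext fun s => and_congr_right fun hs => ?_⟩
  rw [hA (fun v => (D.mem_sort (· ≤ ·)).1) rfl s hs]
  refine ⟨?_, fun h => ⟨s, hs, h, rfl⟩⟩
  rintro ⟨t, ht, hpos, heq⟩
  rwa [injOn_tupleIdx_val hs ht (congrArg (Nat.ofDigits n) heq)]

end teamCommands

/-! ### The greatest satisfying subteam -/

/-- The team `X[A/x]`. -/
abbrev fullSupplement {A : Type} (X : Set (Assignment A)) (x : ℕ) : Set (Assignment A) :=
  supplement X x fun _ => Set.univ

theorem supplement_subset_fullSupplement {A : Type} {X Y : Set (Assignment A)} (h : X ⊆ Y) (x : ℕ)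
    (F : Assignment A → Set A) : supplement X x F ⊆ fullSupplement Y x := by
  rintro _ ⟨s, hs, a, -, rfl⟩
  exact ⟨s, h hs, a, trivial, rfl⟩

theorem supplement_sUnion {A : Type} (C : Set (Set (Assignment A))) (x : ℕ)
    (F : Set (Assignment A) → Assignment A → Set A) {G : Assignment A → Set A}
    (hG : ∀ s ∈ ⋃₀ C, ∀ a, a ∈ G s ↔ ∃ X ∈ C, s ∈ X ∧ a ∈ F X s) :
    supplement (⋃₀ C) x G = ⋃₀ ((fun X => supplement X x (F X)) '' C) := by
  ext t
  constructor
  · rintro ⟨s, hsC, a, ha, rfl⟩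
    obtain ⟨X, hX, hs, ha⟩ := (hG s hsC a).1 ha
    exact ⟨_, ⟨X, hX, rfl⟩, s, hs, a, ha, rfl⟩
  · rintro ⟨_, ⟨X, hX, rfl⟩, s, hs, a, ha, rfl⟩
    exact ⟨s, ⟨X, hX, hs⟩, a, (hG s ⟨X, hX, hs⟩ a).2 ⟨X, hX, hs, ha⟩, rfl⟩

section maxSubteam

variable {σ : Vocabulary} {A : Type} (S : Struct σ A)

theorem sat_or_sUnion {φ ψ : InclFormula σ} {C : Set (Set (Assignment A))}
    (hφ : ∀ C, (∀ X ∈ C, Sat S φ X) → Sat S φ (⋃₀ C))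
    (hψ : ∀ C, (∀ X ∈ C, Sat S ψ X) → Sat S ψ (⋃₀ C)) (h : ∀ X ∈ C, Sat S (φ.or ψ) X) :
    Sat S (φ.or ψ) (⋃₀ C) := by
  choose! Y Z hY hZ hYZ hYφ hZψ using h
  refine ⟨⋃ X ∈ C, Y X, ⋃ X ∈ C, Z X, ?_, ?_, ?_, ?_, ?_⟩
  · exact Set.iUnion₂_subset fun X hX => (hY X hX).trans (Set.subset_sUnion_of_mem hX)
  · exact Set.iUnion₂_subset fun X hX => (hZ X hX).trans (Set.subset_sUnion_of_mem hX)
  · rw [Set.sUnion_eq_biUnion, ← Set.iUnion₂_congr hYZ]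
    simp only [Set.iUnion_union_distrib]
  · rw [← Set.sUnion_image]
    exact hφ _ (Set.forall_mem_image.2 hYφ)
  · rw [← Set.sUnion_image]
    exact hψ _ (Set.forall_mem_image.2 hZψ)

theorem sat_sUnion (φ : InclFormula σ) (C : Set (Set (Assignment A))) (h : ∀ X ∈ C, Sat S φ X) :
    Sat S φ (⋃₀ C) := by
  induction φ generalizing C with
  | eq x y => exact fun s ⟨X, hX, hs⟩ => h X hX s hs
  | neq x y => exact fun s ⟨X, hX, hs⟩ => h X hX s hs
  | rel i x => exact fun s ⟨X, hX, hs⟩ => h X hX s hs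
  | nrel i x => exact fun s ⟨X, hX, hs⟩ => h X hX s hs
  | incl m x y =>
    rintro s ⟨X, hX, hs⟩
    obtain ⟨t, ht, hst⟩ := h X hX s hs
    exact ⟨t, ⟨X, hX, ht⟩, hst⟩
  | and φ ψ ihφ ihψ => exact ⟨ihφ C fun X hX => (h X hX).1, ihψ C fun X hX => (h X hX).2⟩
  | or φ ψ ihφ ihψ => exact sat_or_sUnion S ihφ ihψ h
  | ex x φ ih =>
    choose! F hF hφ using h
    refine ⟨fun s => {a | ∃ X ∈ C, s ∈ X ∧ a ∈ F X s}, ?_, ?_⟩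
    · rintro s ⟨X, hX, hs⟩
      obtain ⟨a, ha⟩ := hF X hX s hs
      exact ⟨a, X, hX, hs, ha⟩
    · rw [supplement_sUnion C x F fun _ _ _ => by rfl]
      exact ih _ (Set.forall_mem_image.2 hφ)
  | all x φ ih =>
    rw [Sat, supplement_sUnion C x (fun _ _ => Set.univ) fun s hs a => by simpa using hs]
    exact ih _ (Set.forall_mem_image.2 h)

/-- The greatest subteam of `X` that satisfies `φ`; it satisfies `φ` by `sat_sUnion`. -/
def maxSubteam (φ : InclFormula σ) (X : Set (Assignment A)) : Set (Assignment A) :=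
  ⋃₀ {Y | Y ⊆ X ∧ Sat S φ Y}

theorem maxSubteam_subset (φ : InclFormula σ) (X : Set (Assignment A)) : maxSubteam S φ X ⊆ X :=
  Set.sUnion_subset fun _ h => h.1

theorem sat_maxSubteam (φ : InclFormula σ) (X : Set (Assignment A)) :
    Sat S φ (maxSubteam S φ X) :=
  sat_sUnion S φ _ fun _ h => h.2

variable {S} in
theorem subset_maxSubteam {φ : InclFormula σ} {X Y : Set (Assignment A)} (h : Y ⊆ X)
    (hY : Sat S φ Y) : Y ⊆ maxSubteam S φ X := Set.subset_sUnion_of_mem ⟨h, hY⟩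

variable {S} in
theorem maxSubteam_eq {φ : InclFormula σ} {X Z : Set (Assignment A)} (h : Z ⊆ X) (hZ : Sat S φ Z)
    (hmax : ∀ Y ⊆ X, Sat S φ Y → Y ⊆ Z) : maxSubteam S φ X = Z :=
  (hmax _ (maxSubteam_subset S φ X) (sat_maxSubteam S φ X)).antisymm (subset_maxSubteam h hZ)

variable {S} in
theorem maxSubteam_of_sat_iff_forall {φ : InclFormula σ} {P : Assignment A → Prop}
    (h : ∀ X, Sat S φ X ↔ ∀ s ∈ X, P s) (X : Set (Assignment A)) :
    maxSubteam S φ X = {s | s ∈ X ∧ P s} :=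
  maxSubteam_eq (fun _ hs => hs.1) ((h _).2 fun _ hs => hs.2)
    fun Y hY hφ s hs => ⟨hY hs, (h Y).1 hφ s hs⟩

theorem maxSubteam_or (φ ψ : InclFormula σ) (X : Set (Assignment A)) :
    maxSubteam S (φ.or ψ) X = maxSubteam S φ X ∪ maxSubteam S ψ X := by
  refine maxSubteam_eq (Set.union_subset (maxSubteam_subset S φ X) (maxSubteam_subset S ψ X)) ?_ ?_
  · exact ⟨_, _, Set.subset_union_left, Set.subset_union_right, rfl, sat_maxSubteam S φ X,
      sat_maxSubteam S ψ X⟩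
  · rintro Y hY ⟨Y₁, Y₂, h₁, h₂, rfl, hφ, hψ⟩
    exact Set.union_subset_union (subset_maxSubteam (h₁.trans hY) hφ)
      (subset_maxSubteam (h₂.trans hY) hψ)

theorem maxSubteam_ex (x : ℕ) (φ : InclFormula σ) (X : Set (Assignment A)) :
    maxSubteam S (φ.ex x) X =
      {s | s ∈ X ∧ ∃ a, s.supp x a ∈ maxSubteam S φ (fullSupplement X x)} := by
  refine maxSubteam_eq (fun _ hs => hs.1) ?_ ?_
  · refine ⟨fun s => {a | s.supp x a ∈ maxSubteam S φ (fullSupplement X x)}, fun s hs => hs.2, ?_⟩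
    convert sat_maxSubteam S φ (fullSupplement X x) using 1
    ext t
    constructor
    · rintro ⟨s, -, a, ha, rfl⟩
      exact ha
    · intro ht
      obtain ⟨s, hs, a, -, rfl⟩ := maxSubteam_subset S _ _ ht
      exact ⟨s, ⟨hs, a, ht⟩, a, ht, rfl⟩
  · rintro Y hY ⟨F, hF, hφ⟩ s hs
    obtain ⟨a, ha⟩ := hF s hs
    exact ⟨hY hs, a, subset_maxSubteam (supplement_subset_fullSupplement hY x F) hφ
      ⟨s, hs, a, ha, rfl⟩⟩

theorem isFixedPt_iterate_of_ncard_le {α : Type*} {f : Set α → Set α} (hf : ∀ Z, f Z ⊆ Z)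
    {X : Set α} (hX : X.Finite) {N : ℕ} (hN : X.ncard ≤ N) :
    Function.IsFixedPt f (f^[N] X) := by
  induction N generalizing X with
  | zero =>
    obtain rfl : X = ∅ := (Set.ncard_eq_zero hX).1 (Nat.le_zero.1 hN)
    exact Set.subset_empty_iff.1 (hf ∅)
  | succ N ih =>
    rw [Function.iterate_succ_apply]
    by_cases h : f X = X
    · rwa [h, Function.iterate_fixed h]
    · have hlt := Set.ncard_lt_ncard ((hf X).ssubset_of_ne h) hX
      exact ih (hX.subset (hf X)) (by omega)

variable {S} in
theorem maxSubteam_eq_iterate {φ : InclFormula σ} {f : Set (Assignment A) → Set (Assignment A)}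
    (hf : ∀ Z, f Z ⊆ Z) (hfix : ∀ Z, f Z = Z → Sat S φ Z)
    (hmax : ∀ Z, ∀ Y ⊆ Z, Sat S φ Y → Y ⊆ f Z) {X : Set (Assignment A)} (hX : X.Finite) {N : ℕ}
    (hN : X.ncard ≤ N) : maxSubteam S φ X = f^[N] X := by
  have hfixed : Sat S φ (f^[N] X) := hfix _ (isFixedPt_iterate_of_ncard_le hf hX hN)
  refine maxSubteam_eq (Function.iterate_le_id_of_le_id hf N X) hfixed fun Y hY hφ => ?_
  clear hN hfixed
  induction N with
  | zero => exact hY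
  | succ N ih =>
    rw [Function.iterate_succ_apply']
    exact hmax _ _ ih hφ

theorem maxSubteam_and (φ ψ : InclFormula σ) {X : Set (Assignment A)} (hX : X.Finite) {N : ℕ}
    (hN : X.ncard ≤ N) :
    maxSubteam S (φ.and ψ) X = (fun Z => maxSubteam S ψ (maxSubteam S φ Z))^[N] X := by
  refine maxSubteam_eq_iterate
    (fun Z => (maxSubteam_subset S ψ _).trans (maxSubteam_subset S φ Z)) (fun Z hZ => ?_)
    (fun Z Y hY hsat => ?_) hX hN
  · have hφ : maxSubteam S φ Z = Z :=
      (maxSubteam_subset S φ Z).antisymm (hZ.superset.trans (maxSubteam_subset S ψ _))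
    rw [hφ] at hZ
    exact ⟨hφ ▸ sat_maxSubteam S φ Z, hZ ▸ sat_maxSubteam S ψ Z⟩
  · exact subset_maxSubteam (subset_maxSubteam hY hsat.1) hsat.2

theorem maxSubteam_incl (m : ℕ) (x y : Fin m → ℕ) {X : Set (Assignment A)} (hX : X.Finite) {N : ℕ}
    (hN : X.ncard ≤ N) :
    maxSubteam S (.incl m x y) X =
      (fun Z => {s | s ∈ Z ∧ ∃ t ∈ Z, ∀ j, s (x j) = t (y j)})^[N] X := by
  refine maxSubteam_eq_iterate (fun Z s hs => hs.1) (fun Z hZ s hs => (hZ.superset hs).2)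
    (fun Z Y hY hφ s hs => ?_) hX hN
  obtain ⟨t, ht, hst⟩ := hφ s hs
  exact ⟨hY hs, t, hY ht, hst⟩

theorem maxSubteam_all (x : ℕ) (φ : InclFormula σ) {X : Set (Assignment A)} (hX : X.Finite) {N : ℕ}
    (hN : X.ncard ≤ N) :
    maxSubteam S (φ.all x) X =
      (fun Z => {s | s ∈ Z ∧ ∀ a, s.supp x a ∈ maxSubteam S φ (fullSupplement Z x)})^[N] X := by
  refine maxSubteam_eq_iterate (fun Z s hs => hs.1) (fun Z hZ => ?_)
    (fun Z Y hY hφ s hs => ?_) hX hN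
  · have hsupp : maxSubteam S φ (fullSupplement Z x) = fullSupplement Z x := by
      refine (maxSubteam_subset S φ _).antisymm ?_
      rintro _ ⟨s, hs, a, -, rfl⟩
      exact (hZ.superset hs).2 a
    have hsat := sat_maxSubteam S φ (fullSupplement Z x)
    rwa [hsupp] at hsat
  · exact ⟨hY hs, fun a => subset_maxSubteam (supplement_subset_fullSupplement hY x _) hφ
      ⟨s, hs, a, trivial, rfl⟩⟩

end maxSubteam

/-- The greatest team over the free variables that satisfies `φ`. -/
def greatestTeam {σ : Vocabulary} (φ : InclFormula σ) (S : FinStruct σ) :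
    Set (Assignment (Fin S.n)) :=
  maxSubteam S.str φ (fullTeam φ.free (Fin S.n))

theorem isGreatest_greatestTeam {σ : Vocabulary} (φ : InclFormula σ) (S : FinStruct σ) :
    IsGreatest (satTeams φ S.str) (greatestTeam φ S) :=
  ⟨⟨⟨(finite_fullTeam _ _).subset (maxSubteam_subset _ _ _), maxSubteam_subset _ _ _⟩,
    sat_maxSubteam _ _ _⟩, fun _ hX => subset_maxSubteam hX.1.2 hX.2⟩

theorem maxTeams_eq {σ : Vocabulary} (φ : InclFormula σ) (S : FinStruct σ) :
    maxTeams φ S.str = {X | X = greatestTeam φ S ∧ X.Nonempty} := by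
  obtain ⟨⟨hT, hsat⟩, hub⟩ := isGreatest_greatestTeam φ S
  ext X
  constructor
  · rintro ⟨hX, hXsat, hne, hmax⟩
    refine ⟨(hub ⟨hX, hXsat⟩).antisymm ?_, hne⟩
    by_contra h
    exact hmax _ hT ⟨hub ⟨hX, hXsat⟩, h⟩ hsat
  · rintro ⟨rfl, hne⟩
    exact ⟨hT, hsat, hne, fun X' hX' hss h => hss.2 (hub ⟨hX', h⟩)⟩

theorem cardMaxTeams_eq {σ : Vocabulary} (φ : InclFormula σ) (S : FinStruct σ) :
    cardMaxTeams φ S.str = {X | X = greatestTeam φ S ∧ X.Nonempty} := by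
  obtain ⟨⟨hT, hsat⟩, hub⟩ := isGreatest_greatestTeam φ S
  ext X
  constructor
  · rintro ⟨hX, hXsat, hne, hmax⟩
    refine ⟨Set.eq_of_subset_of_ncard_le (hub ⟨hX, hXsat⟩) ?_ hT.1, hne⟩
    by_contra h
    exact hmax _ hT (not_le.1 h) hsat
  · rintro ⟨rfl, hne⟩
    exact ⟨hT, hsat, hne, fun X' hX' hlt h =>
      absurd (Set.ncard_le_ncard (hub ⟨hX', h⟩) hT.1) (not_le.2 hlt)⟩

/-! ### Supplements as sets of assignments agreeing on a domain -/

section supplement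

variable {A : Type} {D : Finset ℕ} {x : ℕ}

theorem exists_supp_iff {s : Assignment A} (hs : s ∈ fullTeam D A) (P : Assignment A → Prop) :
    (∃ a, P (s.supp x a)) ↔
      ∃ t ∈ fullTeam (insert x D) A, (∀ v ∈ D.erase x, s v = t v) ∧ P t := by
  constructor
  · rintro ⟨a, ha⟩
    refine ⟨_, fun v => ?_, fun v hv => ?_, ha⟩
    · by_cases hv : v = x <;> simp [Assignment.supp, hv, hs v]
    · simp [Assignment.supp, Finset.ne_of_mem_erase hv]
  · rintro ⟨t, ht, hst, hP⟩
    obtain ⟨a, ha⟩ := exists_eq_some_of_mem_fullTeam ht (D.mem_insert_self x)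
    refine ⟨a, ?_⟩
    convert hP
    funext v
    by_cases hvx : v = x
    · simp [Assignment.supp, hvx, ha]
    · by_cases hv : v ∈ D
      · simp [Assignment.supp, hvx, hst v (Finset.mem_erase.2 ⟨hvx, hv⟩)]
      · simp [Assignment.supp, hvx, eq_none_of_mem_fullTeam hs hv,
          eq_none_of_mem_fullTeam ht (v := v) (by simp [hvx, hv])]

theorem fullSupplement_eq {X : Set (Assignment A)} (hX : X ⊆ fullTeam D A) :
    fullSupplement X x =
      {t | t ∈ fullTeam (insert x D) A ∧ ∃ s ∈ X, ∀ v ∈ D.erase x, s v = t v} := by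
  ext t
  calc t ∈ fullSupplement X x ↔ ∃ s ∈ X, ∃ a, t = s.supp x a := by simp [supplement]
    _ ↔ ∃ s ∈ X, ∃ t' ∈ fullTeam (insert x D) A, (∀ v ∈ D.erase x, s v = t' v) ∧ t = t' :=
      exists_congr fun s => and_congr_right fun hs => exists_supp_iff (hX hs) (t = ·)
    _ ↔ _ := by
      constructor
      · rintro ⟨s, hs, t, ht, hst, rfl⟩
        exact ⟨ht, s, hs, hst⟩
      · rintro ⟨ht, s, hs, hst⟩
        exact ⟨s, hs, t, ht, hst, rfl⟩

end supplement

/-! ### Encoded structures -/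

theorem length_encTuples {n k : ℕ} (R : Set (Fin k → Fin n)) : (encTuples R).length = n ^ k := by
  simp [encTuples]

open Classical in
theorem getElem?_encTuples {n k : ℕ} (R : Set (Fin k → Fin n)) (t : Fin k → Fin n) :
    (encTuples R)[(finFunctionFinEquiv t : ℕ)]? = some (decide (t ∈ R)) := by
  rw [encTuples, List.getElem?_ofFn, dif_pos (finFunctionFinEquiv t).2]
  simp only [Fin.eta, Equiv.symm_apply_apply]

theorem encTuples_of_length {n k : ℕ} {w : List Bool} (hw : w.length = n ^ k) :
    encTuples {t : Fin k → Fin n | w[(finFunctionFinEquiv t : ℕ)]? = some true} = w := by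
  refine List.ext_getElem (by rw [length_encTuples, hw]) fun p hp hp' => ?_
  simp only [encTuples, List.getElem_ofFn, Set.mem_ofPred_eq, Equiv.apply_symm_apply,
    List.getElem?_eq_getElem hp', Option.some.injEq, Bool.decide_eq_true]

theorem univSize_append (n : ℕ) (w : List Bool) :
    univSize (List.replicate n true ++ false :: w) = n := by
  rw [univSize, List.takeWhile_append_of_pos (by simp)]
  simp

theorem exists_eq_append_of_univSize_lt {x : List Bool} (hx : univSize x < x.length) :
    ∃ w, x = List.replicate (univSize x) true ++ false :: w := by
  induction x with
  | nil => simp at hx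
  | cons b x ih =>
    cases b with
    | false => exact ⟨x, rfl⟩
    | true =>
      have hsize : univSize (true :: x) = univSize x + 1 := rfl
      rw [hsize] at hx ⊢
      obtain ⟨w, hw⟩ := ih (by simpa using hx)
      exact ⟨w, by rw [List.replicate_succ, List.cons_append, ← hw]⟩

theorem exists_flatten_ofFn_eq {α : Type*} {m : ℕ} (len : Fin m → ℕ) {w : List α}
    (hw : w.length = (List.ofFn len).sum) :
    ∃ ws : Fin m → List α, (∀ i, (ws i).length = len i) ∧ (List.ofFn ws).flatten = w := by
  have hlen : ((List.ofFn len).splitLengths w).length = m := by simp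
  refine ⟨fun i => ((List.ofFn len).splitLengths w)[i], fun i => ?_, ?_⟩
  · simp [List.splitLengths_length_getElem _ _ hw.ge]
  · conv_rhs => rw [← List.flatten_splitLengths w _ hw.le]
    congr 1
    exact List.ext_getElem (by simp) (by simp)

theorem getElem?_flatten_ofFn {α : Type*} {m : ℕ} (ws : Fin m → List α) (i : Fin m) {p : ℕ}
    (hp : p < (ws i).length) :
    (List.ofFn ws).flatten[(((List.ofFn ws).map List.length).take i).sum + p]? = (ws i)[p]? := by
  rw [← List.getElem?_drop, List.drop_sum_flatten,
    List.drop_eq_getElem_cons (by simp), List.flatten_cons, List.getElem_ofFn,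
    List.getElem?_append_left hp]

/-- The position at which the characteristic word of the relation `i` starts in the code of a
structure with `n` elements; for `i = σ.numRel`, the length of the code. -/
def relOffset (σ : Vocabulary) (n i : ℕ) : ℕ :=
  n + 1 + (((List.ofFn σ.arity).map (n ^ ·)).take i).sum

section enc

variable {σ : Vocabulary} (S : FinStruct σ)

theorem enc_eq : S.enc = List.replicate S.n true ++
    false :: (List.ofFn fun i : Fin σ.numRel => encTuples (S.str.rel i)).flatten := by
  simp [FinStruct.enc]

theorem univSize_enc : univSize S.enc = S.n := by rw [enc_eq, univSize_append]

theorem map_length_encTuples :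
    (List.ofFn fun i : Fin σ.numRel => encTuples (S.str.rel i)).map List.length =
      (List.ofFn σ.arity).map (S.n ^ ·) := by
  simp only [List.map_ofFn, Function.comp_def, length_encTuples]

theorem length_enc : S.enc.length = relOffset σ S.n σ.numRel := by
  rw [enc_eq, List.length_append, List.length_cons, List.length_flatten, map_length_encTuples,
    List.length_replicate, relOffset, List.take_of_length_le (by simp)]
  ring

open Classical in
theorem inputSymbol_enc (i : Fin σ.numRel) (t : Fin (σ.arity i) → Fin S.n) :
    inputSymbol S.enc (relOffset σ S.n i + finFunctionFinEquiv t) =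
      if t ∈ S.str.rel i then 1 else 0 := by
  have hget := getElem?_flatten_ofFn (fun i => encTuples (S.str.rel i)) i
    (p := finFunctionFinEquiv t) (by rw [length_encTuples]; exact (finFunctionFinEquiv t).2)
  rw [map_length_encTuples, getElem?_encTuples] at hget
  unfold inputSymbol relOffset
  rw [enc_eq, List.getElem?_append_right (by simp; omega), List.length_replicate, add_assoc,
    add_assoc, Nat.add_sub_cancel_left, add_comm 1, List.getElem?_cons_succ, hget]
  by_cases h : t ∈ S.str.rel i <;> simp [h]

end enc

theorem exists_eq_enc_iff {σ : Vocabulary} {x : List Bool} :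
    (∃ S : FinStruct σ, x = S.enc) ↔ x.length = relOffset σ (univSize x) σ.numRel := by
  constructor
  · rintro ⟨S, rfl⟩
    rw [univSize_enc, length_enc]
  · intro hx
    obtain ⟨w, hw⟩ := exists_eq_append_of_univSize_lt (x := x) (by rw [hx, relOffset]; omega)
    set n := univSize x
    have hlen : w.length = (List.ofFn fun i => n ^ σ.arity i).sum := by
      rw [hw, relOffset, List.take_of_length_le (by simp), List.map_ofFn] at hx
      simp only [List.length_append, List.length_replicate, List.length_cons] at hx
      simp only [Function.comp_def] at hx
      omega
    obtain ⟨ws, hws, rfl⟩ := exists_flatten_ofFn_eq _ hlen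
    refine ⟨⟨n, ⟨fun i => {t | (ws i)[(finFunctionFinEquiv t : ℕ)]? = some true}⟩⟩, ?_⟩
    simp only [enc_eq, encTuples_of_length (hws _)]
    exact hw

/-! ### Reading encoded structures -/

namespace Expr

/-- The number `n ^ k`, where `n` is the size of the universe. -/
def pow : ℕ → Expr
  | 0 => .const 1
  | k + 1 => .mulSize (pow k)

/-- The sum of the numbers `n ^ k` for `k` in a list, where `n` is the size of the universe. -/
def powSum : List ℕ → Expr
  | [] => .const 0
  | k :: l => .add (pow k) (powSum l)

/-- The number `TeamEnum.relOffset σ n i`, where `n` is the size of the universe. -/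
def relOffset (σ : Vocabulary) (i : ℕ) : Expr :=
  .add (.add (pow 1) (.const 1)) (powSum ((List.ofFn σ.arity).take i))

/-- The test whether the tuple of values of `x` is in the relation `i`. -/
def atom {σ : Vocabulary} (i : Fin σ.numRel) (x : Fin (σ.arity i) → ℕ) : Expr :=
  .input (.add (relOffset σ i) (tuple (List.ofFn x)))

/-- The test whether the position `e` is beyond the input. -/
def beyondInput (e : Expr) : Expr := .sub (.input e) (.const 1)

/-- The test whether the input word is the code of a structure. -/
def isEnc (σ : Vocabulary) : Expr :=
  .sub (beyondInput (relOffset σ σ.numRel))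
    (beyondInput (.sub (relOffset σ σ.numRel) (.const 1)))

variable (x : List Bool) (A : ℕ → ℕ → ℕ) (u : ℕ → ℕ)

theorem eval_pow (k : ℕ) : (pow k).eval x A u = univSize x ^ k := by
  induction k with
  | zero => rfl
  | succ k ih => rw [pow, eval, ih, pow_succ']

theorem eval_powSum (l : List ℕ) :
    (powSum l).eval x A u = (l.map (univSize x ^ ·)).sum := by
  induction l with
  | nil => rfl
  | cons k l ih => rw [powSum, eval, ih, eval_pow, List.map_cons, List.sum_cons]

theorem eval_relOffset (σ : Vocabulary) (i : ℕ) :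
    (relOffset σ i).eval x A u = TeamEnum.relOffset σ (univSize x) i := by
  simp only [relOffset, eval, eval_pow, eval_powSum, pow_one, TeamEnum.relOffset, List.map_take]

theorem eval_beyondInput_le (e : Expr) : (beyondInput e).eval x A u ≤ 1 := by
  rw [beyondInput, eval, eval, eval]
  unfold inputSymbol
  split <;> simp

variable {x A u}

theorem beyondInput_pos_iff {e : Expr} :
    0 < (beyondInput e).eval x A u ↔ x.length ≤ e.eval x A u := by
  rw [beyondInput, eval, eval, eval, ← List.getElem?_eq_none_iff]
  unfold inputSymbol
  split <;> simp_all

theorem isEnc_pos_iff {σ : Vocabulary} :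
    0 < (isEnc σ).eval x A u ↔ ∃ S : FinStruct σ, x = S.enc := by
  rw [exists_eq_enc_iff, isEnc, eval]
  have hend := beyondInput_pos_iff (x := x) (A := A) (u := u) (e := relOffset σ σ.numRel)
  have hlast := beyondInput_pos_iff (x := x) (A := A) (u := u)
    (e := .sub (relOffset σ σ.numRel) (.const 1))
  have hle := eval_beyondInput_le x A u (relOffset σ σ.numRel)
  rw [eval_relOffset] at hend
  rw [eval, eval_relOffset, eval] at hlast
  have hpos : 0 < TeamEnum.relOffset σ (univSize x) σ.numRel := by
    rw [TeamEnum.relOffset]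
    omega
  omega

theorem atom_pos_iff {σ : Vocabulary} (S : FinStruct σ) (i : Fin σ.numRel)
    {v : Fin (σ.arity i) → ℕ} {a : Fin (σ.arity i) → Fin S.n} (hu : ∀ j, u (v j) = a j) :
    0 < (atom i v).eval S.enc A u ↔ a ∈ S.str.rel i := by
  rw [atom, eval, eval, eval_relOffset, eval_tuple, univSize_enc, tupleIdx_ofFn hu, inputSymbol_enc]
  split <;> simp [*]

end Expr

/-! ### Commands transforming teams -/

/-- The data differ at most in the arrays `q, q + 1, …`. -/
structure Data.Preserves (q : ℕ) (d d' : Data) : Prop where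
  sol_eq : d'.sol = d.sol
  outs_eq : d'.outs = d.outs
  arr_eq : ∀ r < q, d'.arr r = d.arr r

namespace Data.Preserves

variable {q r : ℕ} {d d' d'' : Data}

theorem refl (q : ℕ) (d : Data) : d.Preserves q d := ⟨rfl, rfl, fun _ _ => rfl⟩

theorem trans (h : d.Preserves q d') (h' : d'.Preserves q d'') : d.Preserves q d'' :=
  ⟨h'.sol_eq.trans h.sol_eq, h'.outs_eq.trans h.outs_eq,
    fun r hr => (h'.arr_eq r hr).trans (h.arr_eq r hr)⟩

theorem mono (h : d.Preserves r d') (hqr : q ≤ r) : d.Preserves q d' :=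
  ⟨h.sol_eq, h.outs_eq, fun i hi => h.arr_eq i (hi.trans_le hqr)⟩

theorem putArr (hqr : q ≤ r) (d : Data) (A : ℕ → ℕ) : d.Preserves q (d.putArr r A) :=
  ⟨rfl, rfl, fun i hi => by simp [Data.putArr, (hi.trans_le hqr).ne]⟩

end Data.Preserves

/-- Keep those members of the team with domain `D` in the array `q` whose values for `l` are the
values for `l'` of an assignment with domain `E` that makes `e` positive. The array `r` is
auxiliary. -/
def Cmd.semijoin (q : ℕ) (D : Finset ℕ) (l : List ℕ) (r : ℕ) (E : Finset ℕ) (l' : List ℕ)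
    (e : Expr) : Cmd :=
  .seq (.project r E.sort l' e) (.filter q D.sort (.arr r (.tuple l)))

/-- Delete the assignments that `Cmd.semijoin` keeps. -/
def Cmd.antijoin (q : ℕ) (D : Finset ℕ) (l : List ℕ) (r : ℕ) (E : Finset ℕ) (l' : List ℕ)
    (e : Expr) : Cmd :=
  .seq (.project r E.sort l' e) (.filter q D.sort (Expr.arr r (.tuple l)).not)

/-- Make the array `q + 1` the team `X[A/y]`, where `X` is the team with domain `D` in the array
`q`, and execute `c`. The array `q + 2` is auxiliary. -/
def Cmd.onSupplement (y q : ℕ) (D : Finset ℕ) (c : Cmd) : Cmd :=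
  .seq (.project (q + 2) D.sort (D.erase y).sort (.member q D))
    (.seq (.assign (q + 1) (insert y D) (.arr (q + 2) (.tuple (D.erase y).sort))) c)

/-- The command replaces the team `X` with domain `D` in the array `q` by `F X` and changes no
array below `q`. -/
def Cmd.Transforms (x : List Bool) {n : ℕ} (c : Cmd) (D : Finset ℕ) (q : ℕ)
    (F : Set (Assignment (Fin n)) → Set (Assignment (Fin n))) : Prop :=
  ∀ d, d.Preserves q (c.run x 0 d) ∧
    storedTeam n D ((c.run x 0 d).arr q) = F (storedTeam n D (d.arr q))

section transforms

variable {x : List Bool} {n : ℕ} {D E : Finset ℕ} {q r : ℕ} {c c' : Cmd} {l l' : List ℕ} {e : Expr}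
  {F G : Set (Assignment (Fin n)) → Set (Assignment (Fin n))}

theorem Cmd.Transforms.seq (hc : c.Transforms x D q F) (hc' : c'.Transforms x D q G) :
    (Cmd.seq c c').Transforms x D q fun X => G (F X) := fun d =>
  ⟨(hc d).1.trans (hc' _).1, (hc' _).2.trans (congrArg G (hc d).2)⟩

theorem Cmd.Transforms.iterate (hc : c.Transforms x D q F) (N : ℕ) (d : Data) :
    d.Preserves q ((c.run x 0)^[N] d) ∧
      storedTeam n D (((c.run x 0)^[N] d).arr q) = F^[N] (storedTeam n D (d.arr q)) := by
  induction N with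
  | zero => exact ⟨.refl q d, rfl⟩
  | succ N ih =>
    simp only [Function.iterate_succ_apply', (hc _).2, ih.2, and_true]
    exact ih.1.trans (hc _).1

theorem Cmd.Transforms.repeatPow (hc : c.Transforms x D q F) (k : ℕ) :
    (Cmd.repeatPow k c).Transforms x D q F^[univSize x ^ k] := fun d => by
  rw [run_repeatPow]
  exact hc.iterate _ d

variable (hn : univSize x = n)
include hn

theorem Cmd.transforms_filter (he : e.Ignores q) {P : Assignment (Fin n) → Prop}
    (hP : ∀ s ∈ fullTeam D (Fin n), ∀ A, 0 < e.eval x A s.val ↔ P s) :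
    (Cmd.filter q D.sort e).Transforms x D q fun X => {s | s ∈ X ∧ P s} := fun d => by
  obtain ⟨A, hrun, hA⟩ := exists_run_filter_storedTeam hn he D d
  rw [hrun, Data.putArr_arr_self, hA]
  exact ⟨.putArr le_rfl d A, Set.ext fun s => and_congr_right fun hs => hP s hs.1 _⟩

theorem Cmd.run_semijoin (hqr : q < r) (he : e.Ignores r) (hl : ∀ v ∈ l, v ∈ D)
    (hl' : ∀ v ∈ l', v ∈ E) (hlen : l.length = l'.length) (d : Data) :
    d.Preserves q ((Cmd.semijoin q D l r E l' e).run x 0 d) ∧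
      storedTeam n D (((Cmd.semijoin q D l r E l' e).run x 0 d).arr q) =
        {s | s ∈ storedTeam n D (d.arr q) ∧
          ∃ t ∈ fullTeam E (Fin n), 0 < e.eval x d.arr t.val ∧ l.map s.val = l'.map t.val} := by
  obtain ⟨A, hrun, hA⟩ := exists_run_project_team hn he hl' d
  have hpre := Data.Preserves.putArr (q := r) le_rfl d A
  obtain ⟨B, hrun', hB⟩ := exists_run_filter_storedTeam hn
    (Expr.ignores_arr_tuple hqr.ne' l) D (d.putArr r A)
  rw [semijoin, run, hrun, hrun', Data.putArr_arr_self, hB, hpre.arr_eq q hqr]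
  refine ⟨(hpre.mono hqr.le).trans (.putArr le_rfl _ B),
    Set.ext fun s => and_congr_right fun hs => ?_⟩
  rw [← hA hl hlen s hs.1, Expr.eval, Data.putArr_arr_self, Expr.eval_tuple, hn]

theorem Cmd.run_antijoin (hqr : q < r) (he : e.Ignores r) (hl : ∀ v ∈ l, v ∈ D)
    (hl' : ∀ v ∈ l', v ∈ E) (hlen : l.length = l'.length) (d : Data) :
    d.Preserves q ((Cmd.antijoin q D l r E l' e).run x 0 d) ∧
      storedTeam n D (((Cmd.antijoin q D l r E l' e).run x 0 d).arr q) =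
        {s | s ∈ storedTeam n D (d.arr q) ∧
          ¬∃ t ∈ fullTeam E (Fin n), 0 < e.eval x d.arr t.val ∧ l.map s.val = l'.map t.val} := by
  obtain ⟨A, hrun, hA⟩ := exists_run_project_team hn he hl' d
  have hpre := Data.Preserves.putArr (q := r) le_rfl d A
  obtain ⟨B, hrun', hB⟩ := exists_run_filter_storedTeam hn
    (Expr.ignores_arr_tuple hqr.ne' l).not D (d.putArr r A)
  rw [antijoin, run, hrun, hrun', Data.putArr_arr_self, hB, hpre.arr_eq q hqr]
  refine ⟨(hpre.mono hqr.le).trans (.putArr le_rfl _ B),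
    Set.ext fun s => and_congr_right fun hs => ?_⟩
  rw [← hA hl hlen s hs.1, Expr.not_pos_iff, Expr.eval, Data.putArr_arr_self, Expr.eval_tuple, hn]

theorem Cmd.Transforms.run_seq_assign (hc : c.Transforms x D q F) (he : e.Ignores q) (d : Data) :
    d.Preserves q ((Cmd.seq (.assign q D e) c).run x 0 d) ∧
      storedTeam n D (((Cmd.seq (.assign q D e) c).run x 0 d).arr q) =
        F {s | s ∈ fullTeam D (Fin n) ∧ 0 < e.eval x d.arr s.val} := by
  obtain ⟨A, hrun, hA⟩ := exists_run_assign hn he D d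
  rw [run, hrun, (hc _).2, Data.putArr_arr_self, hA]
  exact ⟨(Data.Preserves.putArr le_rfl d A).trans (hc _).1, rfl⟩

theorem Cmd.Transforms.run_onSupplement {y : ℕ} (hc : c.Transforms x (insert y D) (q + 1) F)
    (d : Data) :
    d.Preserves (q + 1) ((Cmd.onSupplement y q D c).run x 0 d) ∧
      storedTeam n (insert y D) (((Cmd.onSupplement y q D c).run x 0 d).arr (q + 1)) =
        F (fullSupplement (storedTeam n D (d.arr q)) y) := by
  have herase : D.erase y ⊆ D := D.erase_subset y
  have hinsert : D.erase y ⊆ insert y D := herase.trans (D.subset_insert y)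
  obtain ⟨A, hrun, hA⟩ := exists_run_project_team hn
    (Expr.ignores_member (show q ≠ q + 2 by omega) D)
    (fun v hv => herase ((Finset.mem_sort (· ≤ ·)).1 hv)) d
  have h := hc.run_seq_assign hn
    (Expr.ignores_arr_tuple (show q + 2 ≠ q + 1 by omega) (D.erase y).sort) (d.putArr (q + 2) A)
  rw [onSupplement, run, hrun, h.2]
  refine ⟨(Data.Preserves.putArr (by omega) d A).trans h.1, congrArg F (Set.ext fun t => ?_)⟩
  rw [fullSupplement_eq (storedTeam_subset n D _), Set.mem_ofPred_eq, Set.mem_ofPred_eq]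
  refine and_congr_right fun ht => ?_
  rw [Expr.eval, Data.putArr_arr_self, Expr.eval_tuple, hn,
    hA (fun v hv => hinsert ((Finset.mem_sort (· ≤ ·)).1 hv)) rfl t ht]
  constructor
  · rintro ⟨s, hs, hpos, hst⟩
    exact ⟨s, (member_pos_iff hn hs q d.arr).1 hpos,
      (map_val_sort_eq_iff hs ht herase hinsert).1 hst.symm⟩
  · rintro ⟨s, hs, hst⟩
    exact ⟨s, hs.1, (member_pos_iff hn hs.1 q d.arr).2 hs,
      ((map_val_sort_eq_iff hs.1 ht herase hinsert).2 hst).symm⟩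

end transforms

/-! ### Computing the greatest satisfying subteam -/

/-- The test whether the variables `x` and `y` have the same value. -/
def Expr.equal (x y : ℕ) : Expr :=
  .not (.add (.sub (.var x) (.var y)) (.sub (.var y) (.var x)))

theorem Expr.equal_pos_iff {w : List Bool} {A : ℕ → ℕ → ℕ} {u : ℕ → ℕ} {x y : ℕ} :
    0 < (equal x y).eval w A u ↔ u x = u y := by
  simp only [equal, not_pos_iff, eval]
  omega

theorem Expr.ignores_equal (x y q : ℕ) : (Expr.equal x y).Ignores q := fun _ _ _ _ => rfl

/-- The command that replaces the team with domain `D` in the array `q` by its greatest satisfying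
subteam. For conjunctions, inclusion atoms and universal quantifiers it iterates a decreasing
operator. -/
def maxSubteamCmd {σ : Vocabulary} : InclFormula σ → Finset ℕ → ℕ → Cmd
  | .eq x y, D, q => .filter q D.sort (.equal x y)
  | .neq x y, D, q => .filter q D.sort (Expr.equal x y).not
  | .rel i x, D, q => .filter q D.sort (.atom i x)
  | .nrel i x, D, q => .filter q D.sort (Expr.atom i x).not
  | .incl _ x y, D, q => .repeatPow D.card
      (.semijoin q D (List.ofFn x) (q + 1) D (List.ofFn y) (.member q D))
  | .and φ ψ, D, q => .repeatPow D.card (.seq (maxSubteamCmd φ D q) (maxSubteamCmd ψ D q))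
  | .or φ ψ, D, q =>
    .seq (.seq (.assign (q + 1) D (.member q D)) (maxSubteamCmd φ D (q + 1)))
      (.seq (.seq (.assign (q + 2) D (.member q D)) (maxSubteamCmd ψ D (q + 2)))
        (.assign q D (.add (.member (q + 1) D) (.member (q + 2) D))))
  | .ex y φ, D, q =>
    .seq (.onSupplement y q D (maxSubteamCmd φ (insert y D) (q + 1)))
      (.semijoin q D (D.erase y).sort (q + 2) (insert y D) (D.erase y).sort
        (.member (q + 1) (insert y D)))
  | .all y φ, D, q => .repeatPow D.card
    (.seq (.onSupplement y q D (maxSubteamCmd φ (insert y D) (q + 1)))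
      (.antijoin q D (D.erase y).sort (q + 2) (insert y D) (D.erase y).sort
        (Expr.member (q + 1) (insert y D)).not))

theorem Expr.ignores_atom {σ : Vocabulary} (i : Fin σ.numRel) (x : Fin (σ.arity i) → ℕ) (q : ℕ) :
    (Expr.atom i x).Ignores q := fun _ _ _ _ => by simp [atom, eval, eval_relOffset]

section maxSubteamCmd

variable {σ : Vocabulary} {S : FinStruct σ} {D : Finset ℕ} {q : ℕ}

theorem ncard_storedTeam_le (n : ℕ) (D : Finset ℕ) (A : ℕ → ℕ) :
    (storedTeam n D A).ncard ≤ n ^ D.card :=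
  (Set.ncard_le_ncard (storedTeam_subset n D A) (finite_fullTeam D n)).trans
    (ncard_fullTeam_le D n)

theorem finite_storedTeam (n : ℕ) (D : Finset ℕ) (A : ℕ → ℕ) : (storedTeam n D A).Finite :=
  (finite_fullTeam D n).subset (storedTeam_subset n D A)

theorem transforms_maxSubteam_of_iterate {φ : InclFormula σ} {c : Cmd}
    {F : Set (Assignment (Fin S.n)) → Set (Assignment (Fin S.n))} (hc : c.Transforms S.enc D q F)
    (hF : ∀ X : Set (Assignment (Fin S.n)), X.Finite → ∀ N, X.ncard ≤ N →
      maxSubteam S.str φ X = F^[N] X) :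
    (Cmd.repeatPow D.card c).Transforms S.enc D q (maxSubteam S.str φ) := fun d => by
  rw [hF _ (finite_storedTeam _ _ _) _ (ncard_storedTeam_le _ _ _)]
  have h := hc.repeatPow D.card d
  rwa [univSize_enc] at h

theorem transforms_maxSubteam_of_forall {φ : InclFormula σ} {e : Expr} (he : e.Ignores q)
    {P : Assignment (Fin S.n) → Prop}
    (hP : ∀ s ∈ fullTeam D (Fin S.n), ∀ A, 0 < e.eval S.enc A s.val ↔ P s)
    (h : ∀ X, Sat S.str φ X ↔ ∀ s ∈ X, P s) :
    (Cmd.filter q D.sort e).Transforms S.enc D q (maxSubteam S.str φ) := by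
  rw [funext (maxSubteam_of_sat_iff_forall h)]
  exact Cmd.transforms_filter (univSize_enc S) he hP

theorem equal_pos_iff_of_mem_fullTeam {x y : ℕ} (hx : x ∈ D) (hy : y ∈ D)
    {s : Assignment (Fin S.n)} (hs : s ∈ fullTeam D (Fin S.n)) (A : ℕ → ℕ → ℕ) :
    0 < (Expr.equal x y).eval S.enc A s.val ↔ s x = s y :=
  Expr.equal_pos_iff.trans (val_eq_val_iff hs hs hx hy)

theorem atom_pos_iff_of_mem_fullTeam {i : Fin σ.numRel} {x : Fin (σ.arity i) → ℕ}
    (hx : ∀ j, x j ∈ D) {s : Assignment (Fin S.n)} (hs : s ∈ fullTeam D (Fin S.n))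
    (A : ℕ → ℕ → ℕ) :
    0 < (Expr.atom i x).eval S.enc A s.val ↔ ∃ a ∈ S.str.rel i, ∀ j, s (x j) = some (a j) := by
  choose a ha using fun j => exists_eq_some_of_mem_fullTeam hs (hx j)
  rw [Expr.atom_pos_iff S i fun j => Assignment.val_of_eq_some (ha j)]
  simp only [ha, Option.some_inj, ← funext_iff, exists_eq_right']

theorem transforms_maxSubteamCmd_incl {m : ℕ} {x y : Fin m → ℕ} (hx : ∀ j, x j ∈ D)
    (hy : ∀ j, y j ∈ D) :
    (maxSubteamCmd (σ := σ) (.incl m x y) D q).Transforms S.enc D q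
      (maxSubteam S.str (.incl m x y)) := by
  refine transforms_maxSubteam_of_iterate (fun d => ?_)
    fun X hX N hN => maxSubteam_incl S.str m x y hX hN
  have h := Cmd.run_semijoin (univSize_enc S) (Nat.lt_succ_self q)
    (Expr.ignores_member (Nat.lt_succ_self q).ne D) (List.forall_mem_ofFn_iff.2 hx)
    (List.forall_mem_ofFn_iff.2 hy) (by simp) d
  refine ⟨h.1, h.2.trans (Set.ext fun s => and_congr_right fun hs => ?_)⟩
  constructor
  · rintro ⟨t, ht, hpos, hst⟩
    exact ⟨t, (member_pos_iff (univSize_enc S) ht q d.arr).1 hpos,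
      (map_val_ofFn_eq_iff hs.1 ht hx hy).1 hst⟩
  · rintro ⟨t, ht, hst⟩
    exact ⟨t, ht.1, (member_pos_iff (univSize_enc S) ht.1 q d.arr).2 ht,
      (map_val_ofFn_eq_iff hs.1 ht.1 hx hy).2 hst⟩

theorem transforms_maxSubteamCmd_or {φ ψ : InclFormula σ}
    (hφ : ∀ q, (maxSubteamCmd φ D q).Transforms S.enc D q (maxSubteam S.str φ))
    (hψ : ∀ q, (maxSubteamCmd ψ D q).Transforms S.enc D q (maxSubteam S.str ψ)) :
    (maxSubteamCmd (φ.or ψ) D q).Transforms S.enc D q (maxSubteam S.str (φ.or ψ)) := by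
  intro d
  have hcopy (r : ℕ) (d : Data) : {s | s ∈ fullTeam D (Fin S.n) ∧
      0 < (Expr.member r D).eval S.enc d.arr s.val} = storedTeam S.n D (d.arr r) :=
    Set.ext fun s => ⟨fun hs => (member_pos_iff (univSize_enc S) hs.1 r _).1 hs.2,
      fun hs => ⟨hs.1, (member_pos_iff (univSize_enc S) hs.1 r _).2 hs⟩⟩
  rw [maxSubteamCmd, Cmd.run, Cmd.run]
  obtain ⟨hpre₁, hteam₁⟩ := (hφ (q + 1)).run_seq_assign (univSize_enc S)
    (Expr.ignores_member (show q ≠ q + 1 by omega) D) d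
  set d₁ := (Cmd.seq (.assign (q + 1) D (.member q D)) (maxSubteamCmd φ D (q + 1))).run S.enc 0 d
  obtain ⟨hpre₂, hteam₂⟩ := (hψ (q + 2)).run_seq_assign (univSize_enc S)
    (Expr.ignores_member (show q ≠ q + 2 by omega) D) d₁
  set d₂ := (Cmd.seq (.assign (q + 2) D (.member q D)) (maxSubteamCmd ψ D (q + 2))).run S.enc 0 d₁
  obtain ⟨A, hrun, hA⟩ := exists_run_assign (univSize_enc S) (q := q)
    (e := .add (.member (q + 1) D) (.member (q + 2) D))
    (fun x A u B => by simp [Expr.member, Expr.eval]) D d₂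
  rw [hcopy] at hteam₁ hteam₂
  rw [hpre₁.arr_eq q (by omega)] at hteam₂
  rw [hrun, Data.putArr_arr_self, hA, maxSubteam_or, ← hteam₁, ← hteam₂,
    ← hpre₂.arr_eq (q + 1) (by omega), ← hcopy, ← hcopy]
  refine ⟨((hpre₁.mono (by omega)).trans (hpre₂.mono (by omega))).trans (.putArr le_rfl d₂ A), ?_⟩
  ext s
  simp only [Expr.eval, Nat.add_pos_iff_pos_or_pos, Set.mem_union, Set.mem_ofPred_eq, and_or_left]

theorem exists_eval_pos_iff_exists_supp {n y : ℕ} {s : Assignment (Fin n)}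
    (hs : s ∈ fullTeam D (Fin n)) {x : List Bool} {A : ℕ → ℕ → ℕ} {e : Expr}
    {P : Assignment (Fin n) → Prop}
    (hP : ∀ t ∈ fullTeam (insert y D) (Fin n), 0 < e.eval x A t.val ↔ P t) :
    (∃ t ∈ fullTeam (insert y D) (Fin n), 0 < e.eval x A t.val ∧
      (D.erase y).sort.map s.val = (D.erase y).sort.map t.val) ↔ ∃ a, P (s.supp y a) := by
  rw [exists_supp_iff hs]
  refine exists_congr fun t => and_congr_right fun ht => ?_
  rw [hP t ht, and_comm, map_val_sort_eq_iff hs ht (D.erase_subset y)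
    ((D.erase_subset y).trans (D.subset_insert y))]

theorem transforms_maxSubteamCmd_ex {φ : InclFormula σ} {y : ℕ}
    (hφ : (maxSubteamCmd φ (insert y D) (q + 1)).Transforms S.enc (insert y D) (q + 1)
      (maxSubteam S.str φ)) :
    (maxSubteamCmd (φ.ex y) D q).Transforms S.enc D q (maxSubteam S.str (φ.ex y)) := by
  intro d
  have hsort : ∀ v ∈ (D.erase y).sort, v ∈ D := fun v hv =>
    Finset.mem_of_mem_erase ((Finset.mem_sort (· ≤ ·)).1 hv)
  obtain ⟨hpre, hteam⟩ := hφ.run_onSupplement (univSize_enc S) d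
  obtain ⟨hpre', hteam'⟩ := Cmd.run_semijoin (univSize_enc S) (show q < q + 2 by omega)
    (Expr.ignores_member (show q + 1 ≠ q + 2 by omega) (insert y D)) hsort
    (fun v hv => Finset.mem_insert_of_mem (hsort v hv)) rfl
    ((Cmd.onSupplement y q D (maxSubteamCmd φ (insert y D) (q + 1))).run S.enc 0 d)
  refine ⟨(hpre.mono (Nat.le_succ q)).trans hpre', ?_⟩
  rw [maxSubteamCmd, Cmd.run, hteam', hpre.arr_eq q (Nat.lt_succ_self q), maxSubteam_ex, ← hteam]
  exact Set.ext fun s => and_congr_right fun hs => exists_eval_pos_iff_exists_supp hs.1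
    fun t ht => member_pos_iff (univSize_enc S) ht _ _

theorem transforms_maxSubteamCmd_all {φ : InclFormula σ} {y : ℕ}
    (hφ : (maxSubteamCmd φ (insert y D) (q + 1)).Transforms S.enc (insert y D) (q + 1)
      (maxSubteam S.str φ)) :
    (maxSubteamCmd (φ.all y) D q).Transforms S.enc D q (maxSubteam S.str (φ.all y)) := by
  refine transforms_maxSubteam_of_iterate (fun d => ?_)
    fun X hX N hN => maxSubteam_all S.str y φ hX hN
  have hsort : ∀ v ∈ (D.erase y).sort, v ∈ D := fun v hv =>
    Finset.mem_of_mem_erase ((Finset.mem_sort (· ≤ ·)).1 hv)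
  obtain ⟨hpre, hteam⟩ := hφ.run_onSupplement (univSize_enc S) d
  obtain ⟨hpre', hteam'⟩ := Cmd.run_antijoin (univSize_enc S) (show q < q + 2 by omega)
    (Expr.ignores_member (show q + 1 ≠ q + 2 by omega) (insert y D)).not hsort
    (fun v hv => Finset.mem_insert_of_mem (hsort v hv)) rfl
    ((Cmd.onSupplement y q D (maxSubteamCmd φ (insert y D) (q + 1))).run S.enc 0 d)
  refine ⟨(hpre.mono (Nat.le_succ q)).trans hpre', ?_⟩
  rw [Cmd.run, hteam', hpre.arr_eq q (Nat.lt_succ_self q), ← hteam]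
  refine Set.ext fun s => and_congr_right fun hs => ?_
  rw [exists_eval_pos_iff_exists_supp hs.1 fun t ht =>
    Expr.not_pos_iff.trans (member_pos_iff (univSize_enc S) ht _ _).not, not_exists_not]

theorem transforms_maxSubteamCmd (S : FinStruct σ) (φ : InclFormula σ) {D : Finset ℕ}
    (hD : φ.free ⊆ D) (q : ℕ) :
    (maxSubteamCmd φ D q).Transforms S.enc D q (maxSubteam S.str φ) := by
  induction φ generalizing D q with
  | eq x y =>
    exact transforms_maxSubteam_of_forall (Expr.ignores_equal x y q) (fun s hs =>
      equal_pos_iff_of_mem_fullTeam (hD (by simp [InclFormula.free]))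
        (hD (by simp [InclFormula.free])) hs) fun X => Iff.rfl
  | neq x y =>
    exact transforms_maxSubteam_of_forall (Expr.ignores_equal x y q).not (fun s hs A =>
      Expr.not_pos_iff.trans (equal_pos_iff_of_mem_fullTeam (hD (by simp [InclFormula.free]))
        (hD (by simp [InclFormula.free])) hs A).not) fun X => Iff.rfl
  | rel i x =>
    exact transforms_maxSubteam_of_forall (Expr.ignores_atom i x q) (fun s hs =>
      atom_pos_iff_of_mem_fullTeam (fun j => hD (by simp [InclFormula.free])) hs) fun X => Iff.rfl
  | nrel i x =>
    exact transforms_maxSubteam_of_forall (Expr.ignores_atom i x q).not (fun s hs A =>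
      Expr.not_pos_iff.trans (atom_pos_iff_of_mem_fullTeam
        (fun j => hD (by simp [InclFormula.free])) hs A).not) fun X => Iff.rfl
  | incl m x y =>
    exact transforms_maxSubteamCmd_incl (fun j => hD (by simp [InclFormula.free]))
      fun j => hD (by simp [InclFormula.free])
  | and φ ψ ihφ ihψ =>
    rw [InclFormula.free, Finset.union_subset_iff] at hD
    exact transforms_maxSubteam_of_iterate ((ihφ hD.1 q).seq (ihψ hD.2 q))
      fun X hX N hN => maxSubteam_and S.str φ ψ hX hN
  | or φ ψ ihφ ihψ =>
    rw [InclFormula.free, Finset.union_subset_iff] at hD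
    exact transforms_maxSubteamCmd_or (ihφ hD.1) (ihψ hD.2)
  | ex y φ ih => exact transforms_maxSubteamCmd_ex (ih (Finset.subset_insert_iff.2 hD) (q + 1))
  | all y φ ih => exact transforms_maxSubteamCmd_all (ih (Finset.subset_insert_iff.2 hD) (q + 1))

end maxSubteamCmd

/-! ### Enumeration of the greatest satisfying team -/

theorem ofFn_orderEmbOfFin (D : Finset ℕ) : List.ofFn (D.orderEmbOfFin rfl) = D.sort := by
  rw [List.ofFn_eq_map, Finset.listMap_orderEmbOfFin_finRange]

theorem exists_mem_fullTeam_orderEmbOfFin {D : Finset ℕ} {A : Type} (t : Fin D.card → A) :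
    ∃ s ∈ fullTeam D A, ∀ j, s (D.orderEmbOfFin rfl j) = some (t j) := by
  refine ⟨fun v => if h : v ∈ D then some (t ((D.orderIsoOfFin rfl).symm ⟨v, h⟩)) else none,
    fun v => by simp, fun j => ?_⟩
  have hj : (⟨D.orderEmbOfFin rfl j, D.orderEmbOfFin_mem rfl j⟩ : D) = D.orderIsoOfFin rfl j :=
    Subtype.ext (D.coe_orderIsoOfFin_apply rfl j).symm
  simp only [dif_pos (D.orderEmbOfFin_mem rfl j), hj, OrderIso.symm_apply_apply]

theorem encTeam_storedTeam (n : ℕ) (D : Finset ℕ) (A : ℕ → ℕ) :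
    encTeam D (storedTeam n D A) = (List.range (n ^ D.card)).map fun p => decide (0 < A p) := by
  refine List.ext_getElem (by simp [encTeam, length_encTuples]) fun p hp hp' => ?_
  have hpn : p < n ^ D.card := by simpa using hp'
  obtain ⟨t, ht⟩ := finFunctionFinEquiv.surjective (⟨p, hpn⟩ : Fin (n ^ D.card))
  have hidx {s : Assignment (Fin n)} (hs : ∀ j, s (D.orderEmbOfFin rfl j) = some (t j)) :
      tupleIdx n D.sort s.val = p := by
    rw [← ofFn_orderEmbOfFin, tupleIdx_ofFn fun j => Assignment.val_of_eq_some (hs j), ht]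
  simp only [encTeam, encTuples, List.getElem_ofFn, List.getElem_map, List.getElem_range,
    decide_eq_decide, ← ht, Equiv.symm_apply_apply, Set.mem_ofPred_eq]
  constructor
  · rintro ⟨s, hs, hst⟩
    exact hidx hst ▸ hs.2
  · intro hA
    obtain ⟨s, hs, hst⟩ := exists_mem_fullTeam_orderEmbOfFin t
    exact ⟨s, ⟨hs, (hidx hst).symm ▸ hA⟩, hst⟩

/-- Output the code of the team with domain `D` in the array `q`. -/
def Cmd.outputTeam (q : ℕ) (D : Finset ℕ) : Cmd :=
  .seq (.forAll D.sort (.outBit (.member q D))) .output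

theorem Cmd.outs_run_outputTeam {x : List Bool} {n : ℕ} (hn : univSize x = n) (q : ℕ)
    (D : Finset ℕ) (d : Data) :
    ((Cmd.outputTeam q D).run x 0 d).outs =
      d.outs ++ [d.sol ++ encTeam D (storedTeam n D (d.arr q))] := by
  have hrun (L : List (ℕ → ℕ)) (d : Data) :
      L.foldl (fun d u => (Cmd.outBit (.member q D)).run x u d) d = { d with
        sol := d.sol ++ (L.map (tupleIdx n D.sort)).map fun p => decide (0 < d.arr q p) } := by
    induction L generalizing d with
    | nil => simp
    | cons u L ih =>
      rw [List.foldl_cons, ih]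
      simp [run, Data.writeBit, Expr.member, Expr.eval, hn]
  rw [outputTeam, run, run_forAll, hrun, hn, map_tupleIdx_envs n (D.sort_nodup _), D.length_sort,
    ← encTeam_storedTeam]
  rfl

/-- Make the array `0` the greatest satisfying team. -/
def greatestTeamCmd {σ : Vocabulary} (φ : InclFormula σ) : Cmd :=
  .seq (.assign 0 φ.free (.const 1)) (maxSubteamCmd φ φ.free 0)

/-- The test whether the team with domain `D` in the array `q` is not empty, followed by `c` if this
is so. The array `q + 1` is auxiliary. -/
def Cmd.ifNonempty (q : ℕ) (D : Finset ℕ) (c : Cmd) : Cmd :=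
  .seq (.project (q + 1) D.sort [] (.member q D)) (.ite (.arr (q + 1) (.const 0)) c .skip)

open Classical in
theorem Cmd.exists_run_ifNonempty {x : List Bool} {n : ℕ} (hn : univSize x = n) (q : ℕ)
    (D : Finset ℕ) (c : Cmd) (d : Data) :
    ∃ d', d.Preserves (q + 1) d' ∧ (Cmd.ifNonempty q D c).run x 0 d =
      if (storedTeam n D (d.arr q)).Nonempty then c.run x 0 d' else d' := by
  obtain ⟨A, hrun, hA⟩ := exists_run_project_team hn (Expr.ignores_member q.lt_succ_self.ne D)
    (l' := []) nofun d
  refine ⟨_, .putArr le_rfl d A, ?_⟩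
  have hflag : 0 < A 0 ↔ (storedTeam n D (d.arr q)).Nonempty := by
    refine (hA (D := ∅) (l := []) nofun rfl (fun _ => none) fun v => by simp).trans ?_
    constructor
    · rintro ⟨t, ht, hpos, -⟩
      exact ⟨t, (member_pos_iff hn ht q d.arr).1 hpos⟩
    · rintro ⟨t, ht⟩
      exact ⟨t, ht.1, (member_pos_iff hn ht.1 q d.arr).2 ht, rfl⟩
  simp only [ifNonempty, run, hrun, Expr.eval, Data.putArr_arr_self, hflag]

/-- The command that outputs the greatest satisfying team if it is not empty, provided that the
input is the code of a structure. -/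
def enumerationCmd {σ : Vocabulary} (φ : InclFormula σ) : Cmd :=
  .ite (.isEnc σ)
    (.seq (greatestTeamCmd φ) (.ifNonempty 0 φ.free (.outputTeam 0 φ.free))) .skip

section

variable {σ : Vocabulary} (φ : InclFormula σ)

theorem run_greatestTeamCmd (S : FinStruct σ) (d : Data) :
    d.Preserves 0 ((greatestTeamCmd φ).run S.enc 0 d) ∧
      storedTeam S.n φ.free (((greatestTeamCmd φ).run S.enc 0 d).arr 0) = greatestTeam φ S := by
  have h := (transforms_maxSubteamCmd S φ subset_rfl 0).run_seq_assign (univSize_enc S)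
    (e := .const 1) (fun _ _ _ _ => rfl) d
  refine ⟨h.1, h.2.trans (congrArg (maxSubteam S.str φ) ?_)⟩
  simp [Expr.eval]

theorem polyTimeComputable_greatestTeam :
    PolyTimeComputable FinStruct.enc fun S => encTeam φ.free (greatestTeam φ S) := by
  obtain ⟨M, p, hM⟩ := (Cmd.seq (greatestTeamCmd φ) (.outputTeam 0 φ.free)).exists_enumerates
  refine ⟨M, p, fun S => ?_⟩
  have h := hM S.enc
  obtain ⟨hpre, hteam⟩ := run_greatestTeamCmd φ S Data.init
  rwa [Cmd.run, Cmd.outs_run_outputTeam (univSize_enc S), hpre.outs_eq, hpre.sol_eq, hteam] at h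

open Classical in
theorem outs_run_enumerationCmd_enc (S : FinStruct σ) :
    ((enumerationCmd φ).run S.enc 0 Data.init).outs =
      if (greatestTeam φ S).Nonempty then [encTeam φ.free (greatestTeam φ S)] else [] := by
  obtain ⟨hpre, hteam⟩ := run_greatestTeamCmd φ S Data.init
  obtain ⟨d, hpre', hrun⟩ := Cmd.exists_run_ifNonempty (univSize_enc S) 0 φ.free
    (.outputTeam 0 φ.free) ((greatestTeamCmd φ).run S.enc 0 Data.init)
  rw [enumerationCmd, Cmd.run, if_pos (Expr.isEnc_pos_iff.2 ⟨S, rfl⟩), Cmd.run, hrun, hteam,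
    apply_ite Data.outs, Cmd.outs_run_outputTeam (univSize_enc S), hpre'.arr_eq 0 one_pos, hteam,
    hpre'.outs_eq, hpre.outs_eq, hpre'.sol_eq, hpre.sol_eq]
  rfl

theorem outs_run_enumerationCmd_of_not_exists {x : List Bool}
    (hx : ¬∃ S : FinStruct σ, x = S.enc) : ((enumerationCmd φ).run x 0 Data.init).outs = [] := by
  rw [enumerationCmd, Cmd.run, if_neg (mt Expr.isEnc_pos_iff.1 hx)]
  rfl

theorem nodup_outs_run_enumerationCmd (x : List Bool) :
    ((enumerationCmd φ).run x 0 Data.init).outs.Nodup := by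
  by_cases hx : ∃ S : FinStruct σ, x = S.enc
  · obtain ⟨S, rfl⟩ := hx
    rw [outs_run_enumerationCmd_enc]
    split <;> simp
  · rw [outs_run_enumerationCmd_of_not_exists φ hx]
    exact List.nodup_nil

open Classical in
theorem mem_outs_run_enumerationCmd {x w : List Bool} :
    w ∈ ((enumerationCmd φ).run x 0 Data.init).outs ↔ ∃ S : FinStruct σ, x = S.enc ∧
      (greatestTeam φ S).Nonempty ∧ w = encTeam φ.free (greatestTeam φ S) := by
  constructor
  · intro hw
    by_cases hx : ∃ S : FinStruct σ, x = S.enc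
    · obtain ⟨S, rfl⟩ := hx
      rw [outs_run_enumerationCmd_enc, List.mem_ite_nil_right, List.mem_singleton] at hw
      exact ⟨S, rfl, hw⟩
    · simp [outs_run_enumerationCmd_of_not_exists φ hx] at hw
  · rintro ⟨S, rfl, hne, rfl⟩
    rw [outs_run_enumerationCmd_enc, if_pos hne]
    exact List.mem_singleton_self _

theorem mem_delP_of_forall {E : EnumProblem}
    (hE : ∀ x w, w ∈ E x ↔ ∃ S : FinStruct σ, x = S.enc ∧ (greatestTeam φ S).Nonempty ∧
      w = encTeam φ.free (greatestTeam φ S)) : E ∈ DelP := by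
  obtain ⟨M, p, hM⟩ := (enumerationCmd φ).exists_enumerates
  exact ⟨∅, empty_mem_pTime, M, p, fun x => ⟨_, nodup_outs_run_enumerationCmd φ x,
    Set.ext fun w => (mem_outs_run_enumerationCmd φ).trans (hE x w).symm, hM x⟩⟩

end

end TeamEnum

theorem mainTheorem10 (σ : Vocabulary) (φ : InclFormula σ) :
    (EMaxSat φ ∈ DelP ∧ ECardMaxSat φ ∈ DelP) ∧
    ∃ T : (S : FinStruct σ) → Set (Assignment (Fin S.n)),
      (∀ S : FinStruct σ,
        IsGreatest (satTeams φ S.str) (T S) ∧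
        maxTeams φ S.str = {X | X = T S ∧ X.Nonempty} ∧
        cardMaxTeams φ S.str = {X | X = T S ∧ X.Nonempty}) ∧
      PolyTimeComputable FinStruct.enc (fun S => encTeam φ.free (T S)) := by
  refine ⟨⟨mem_delP_of_forall φ fun x w => ?_, mem_delP_of_forall φ fun x w => ?_⟩,
    greatestTeam φ, fun S => ⟨isGreatest_greatestTeam φ S, maxTeams_eq φ S, cardMaxTeams_eq φ S⟩,
    polyTimeComputable_greatestTeam φ⟩
  · simp only [EMaxSat, maxTeams_eq, Set.mem_ofPred_eq, and_assoc, exists_eq_left]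
  · simp only [ECardMaxSat, cardMaxTeams_eq, Set.mem_ofPred_eq, and_assoc, exists_eq_left]
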